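/- Let $\kappa,\sigma,\beta,\rho,\bar y>0$, $c\ge 0$, $\mu\in\mathbb R$. Let $W$ be a standard Brownian motion and, for $x\in\mathbb R$, $y\in[0,\bar y]$, let $X^{x,y}$ solve $dX_t=\kappa\big((\mu-\beta y)-X_t\big)dt+\sigma\,dW_t$, $X_0=x$. Put $$R(x,y)=\mathbb E\Big[\int_0^\infty e^{-\rho t}X^{x,y}_t\,y\,dt\Big],\qquad \mathcal L^yu=\tfrac12\sigma^2u_{xx}+\kappa\big((\mu-\beta y)-x\big)u_x ,$$ $$\psi(x)=e^{\frac{\kappa(x-\mu)^2}{2\sigma^2}}D_{-\rho/\kappa}\Big(-\frac{x-\mu}{\sigma}\sqrt{2\kappa}\Big),\qquad D_\alpha(x)=\frac{e^{-x^2/4}}{\Gamma(-\alpha)}\int_0^\infty t^{-\alpha-1}e^{-t^2/2-xt}\,dt\quad(\alpha<0),$$ the positive strictly increasing solution of $\tfrac12\sigma^2u''+\kappa(\mu-x)u'-\rho u=0$. Let $Q_k=\psi^{(k)}\psi^{(k+2)}-(\psi^{(k+1)})^2$, so that $Q_k'=\psi^{(k)}\psi^{(k+3)}-\psi^{(k+1)}\psi^{(k+2)}$,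 and $$\tilde R(z,y)=\frac{\mu\kappa+\rho z-\beta(\rho+2\kappa)y}{\rho(\rho+\kappa)},\qquad H(z)=\psi'(z)\big(c-\tilde R(z,\bar y)\big)+\frac{\psi(z)}{\rho+\kappa},$$ $$D(y,z)=\psi(z)\big[(\rho+\kappa)(c-\tilde R(z,y))Q_1(z)+Q_0'(z)\big],$$ $$N(y,z)=Q_0(z)\Big[\tfrac{\rho+2\kappa}{\rho}\psi'(z)+(\rho+\kappa)(c-\tilde R(z,y))\psi''(z)+\psi'(z)\Big].$$ **Proposition.** There is a differentiable function $\tilde F:[0,\bar y]\to\mathbb R$ with $H(\tilde F(\bar y))=0$ and, for all $y\in[0,\bar y]$, $D(y,\tilde F(y))\neq0$ and $\tilde F'(y)=\beta\,N(y,\tilde F(y))/D(y,\tilde F(y))$. For every such $\tilde F$, the function $F(y)=\tilde F(y)-\beta y$ is strictly increasing on $[0,\bar y]$. Let $\bar x=F(\bar y)$, $$A(y)=\beta^{-1}\,\frac{\psi'(\tilde F(y))\big(c-\tilde R(\tilde F(y),y)\big)+(\rho+\kappa)^{-1}\psi(\tilde F(y))}{-Q_0(\tilde F(y))},$$ $\mathbb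 W=\{(x,y)\in\mathbb R\times[0,\bar y): x<F(y)\}$, $\mathbb I=\{(x,y)\in\mathbb R\times[0,\bar y): x\ge F(y)\}$, $\mathbb I_1=\{(x,y)\in\mathbb I: x<\bar x\}$, $\mathbb I_2=\{(x,y)\in\mathbb R\times[0,\bar y): x\ge\bar x\}$, and define $w:\mathbb R\times[0,\bar y]\to\mathbb R$ by $$w(x,y)=\begin{cases}A(y)\psi(x+\beta y)+R(x,y), & (x,y)\in\mathbb W\cup\big((-\infty,\bar x)\times\{\bar y\}\big),\\ A(F^{-1}(x))\psi(x+\beta F^{-1}(x))+R(x,F^{-1}(x))-c(F^{-1}(x)-y), & (x,y)\in\mathbb I_1,\\ R(x,\bar y)-c(\bar y-y), & (x,y)\in\mathbb I_2\cup\big([\bar x,\infty)\times\{\bar y\}\big).\end{cases}$$ Then $w\in C^{2,1}(\mathbb R\times[0,\bar y])$ (that is, $w,w_x,w_{xx},w_y$ exist and are jointly continuous on $\mathbb R\times[0,\bar y]$, with $w_y$ one-sided at $y=0$ and $y=\bar y$), $w(x,\bar y)=R(x,\bar y)$ for all $x\in\mathbb R$, and $$\max\big\{\mathcal L^yw(x,y)-\rho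 w(x,y)+xy,\ w_y(x,y)-c\big\}=0\qquad\text{for all }(x,y)\in\mathbb R\times[0,\bar y).$$ Moreover $\mathcal L^yw-\rho w+xy=0$ on $\mathbb W$ and $w_y=c$ on $\mathbb I$. -/

import Mathlib

open MeasureTheory ProbabilityTheory Set
open scoped NNReal

namespace SolarInstallation

noncomputable section

/-- The constants of the model: mean-reversion speed `κ`, volatility `σ`, mean level `μ`,
price impact `β`, discount rate `ρ`, proportional cost `c`, maximal installed power `ymax`. -/
structure Params where
  κ : ℝ
  σ : ℝ
  μ : ℝ
  β : ℝ
  ρ : ℝ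
  c : ℝ
  ymax : ℝ

/-- The standing sign conventions on the constants. -/
structure Params.Admissible (p : Params) : Prop where
  κ_pos : 0 < p.κ
  σ_pos : 0 < p.σ
  β_pos : 0 < p.β
  ρ_pos : 0 < p.ρ
  c_nonneg : 0 ≤ p.c
  ymax_pos : 0 < p.ymax

/-! ### The price without installation and its expected profit -/

section Price

variable {Ω : Type*} [MeasurableSpace Ω]

/-- `Z` is (almost surely) the continuous solution of
`dZ_t = κ ((μ - β y) - Z_t) dt + σ dW_t`, `Z_0 = x`. The noise is additive, so that the equation
is an identity between paths and needs no stochastic integral. -/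
def IsPriceProcess (P : Measure Ω) (W : ℝ≥0 → Ω → ℝ) (p : Params) (x y : ℝ)
    (Z : ℝ≥0 → Ω → ℝ) : Prop :=
  ∀ᵐ ω ∂P, Continuous (fun t : ℝ≥0 => Z t ω) ∧
    ∀ t : ℝ≥0, Z t ω =
      x + (∫ s in (0 : ℝ)..(t : ℝ), p.κ * ((p.μ - p.β * y) - Z s.toNNReal ω)) + p.σ * W t ω

/-- The expected discounted profit `R(x,y) = E[∫₀^∞ e^{-ρ t} X_t^{x,y} y dt]` of never installing,
where `X x y` is the price process started at `x` under the constant power level `y`. -/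
def R (P : Measure Ω) (X : ℝ → ℝ → ℝ≥0 → Ω → ℝ) (p : Params) (x y : ℝ) : ℝ :=
  ∫ ω, (∫ t in Ioi (0 : ℝ), Real.exp (-p.ρ * t) * X x y t.toNNReal ω * y) ∂P

end Price

/-! ### The increasing fundamental solution -/

/-- The cylinder function `D_α` of order `α < 0`. -/
def cylinderD (α x : ℝ) : ℝ :=
  Real.exp (-x ^ 2 / 4) / Real.Gamma (-α) *
    ∫ t in Ioi (0 : ℝ), t ^ (-α - 1) * Real.exp (-t ^ 2 / 2 - x * t)

/-- The positive strictly increasing fundamental solution `ψ` of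
`σ²/2 u'' + κ (μ - x) u' - ρ u = 0`. -/
def psi (p : Params) (x : ℝ) : ℝ :=
  Real.exp (p.κ * (x - p.μ) ^ 2 / (2 * p.σ ^ 2)) *
    cylinderD (-p.ρ / p.κ) (-((x - p.μ) / p.σ) * √(2 * p.κ))

/-- The derivative `ψ^{(k)}`. -/
def psiD (p : Params) (k : ℕ) (x : ℝ) : ℝ := iteratedDeriv k (psi p) x

/-- `Q_k = ψ^{(k)} ψ^{(k+2)} - (ψ^{(k+1)})²`. -/
def Q (p : Params) (k : ℕ) (z : ℝ) : ℝ :=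
  psiD p k z * psiD p (k + 2) z - psiD p (k + 1) z ^ 2

/-- `Q_k' = ψ^{(k)} ψ^{(k+3)} - ψ^{(k+1)} ψ^{(k+2)}`. -/
def Qderiv (p : Params) (k : ℕ) (z : ℝ) : ℝ :=
  psiD p k z * psiD p (k + 3) z - psiD p (k + 1) z * psiD p (k + 2) z

/-! ### The free boundary -/

/-- `R_y(x - β y, y)`, as a function of `(x, y)`. -/
def Rtilde (p : Params) (x y : ℝ) : ℝ :=
  (p.μ * p.κ + p.ρ * x - p.β * (p.ρ + 2 * p.κ) * y) / (p.ρ * (p.ρ + p.κ))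

/-- The function whose zero is the terminal value of the shifted free boundary. -/
def H (p : Params) (x : ℝ) : ℝ :=
  psiD p 1 x * (p.c - Rtilde p x p.ymax) + (p.ρ + p.κ)⁻¹ * psi p x

/-- The denominator of the vector field of the free-boundary equation. -/
def ODEden (p : Params) (y z : ℝ) : ℝ :=
  psi p z * ((p.ρ + p.κ) * (p.c - Rtilde p z y) * Q p 1 z + Qderiv p 0 z)

/-- The numerator of the vector field of the free-boundary equation. -/
def ODEnum (p : Params) (y z : ℝ) : ℝ :=
  Q p 0 z * ((p.ρ + 2 * p.κ) / p.ρ * psiD p 1 z +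
    ((p.ρ + p.κ) * (p.c - Rtilde p z y) * psiD p 2 z + psiD p 1 z))

/-- `Ft` is a solution on `[0, ymax]` of `Ft'(y) = β N(y, Ft y) / D(y, Ft y)` that stays in the
domain `{D ≠ 0}` of the vector field, with terminal value a zero of `H`
(one-sided derivatives at the end points). -/
structure IsShiftedBoundary (p : Params) (Ft : ℝ → ℝ) : Prop where
  terminal : H p (Ft p.ymax) = 0
  den_ne_zero : ∀ y ∈ Icc 0 p.ymax, ODEden p y (Ft y) ≠ 0
  ode : ∀ y ∈ Icc 0 p.ymax,
    HasDerivWithinAt Ft (p.β * (ODEnum p y (Ft y) / ODEden p y (Ft y))) (Icc 0 p.ymax) y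

/-- The free boundary `F(y) = Ft(y) - β y`. -/
def boundary (p : Params) (Ft : ℝ → ℝ) (y : ℝ) : ℝ := Ft y - p.β * y

/-- The inverse of the free boundary on `F([0, ymax])`. -/
def boundaryInv (p : Params) (Ft : ℝ → ℝ) (x : ℝ) : ℝ :=
  Function.invFunOn (boundary p Ft) (Icc 0 p.ymax) x

/-- `x̄ = F(ymax)`. -/
def xbar (p : Params) (Ft : ℝ → ℝ) : ℝ := boundary p Ft p.ymax

/-- The waiting region. -/
def waiting (p : Params) (Ft : ℝ → ℝ) : Set (ℝ × ℝ) :=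
  {q | q.2 ∈ Ico 0 p.ymax ∧ q.1 < boundary p Ft q.2}

/-- The installation region. -/
def installation (p : Params) (Ft : ℝ → ℝ) : Set (ℝ × ℝ) :=
  {q | q.2 ∈ Ico 0 p.ymax ∧ boundary p Ft q.2 ≤ q.1}

/-- The part of the installation region to the left of `x̄`. -/
def installation₁ (p : Params) (Ft : ℝ → ℝ) : Set (ℝ × ℝ) :=
  {q | q.2 ∈ Ico 0 p.ymax ∧ q.1 ∈ Ico (boundary p Ft q.2) (xbar p Ft)}

/-! ### The candidate value function -/

/-- The coefficient `A` of `ψ(x + β y)` in the waiting region. -/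
def coeffA (p : Params) (Ft : ℝ → ℝ) (y : ℝ) : ℝ :=
  p.β⁻¹ * ((psiD p 1 (Ft y) * (p.c - Rtilde p (Ft y) y) + (p.ρ + p.κ)⁻¹ * psi p (Ft y)) /
    (-Q p 0 (Ft y)))

open Classical in
/-- The candidate value function, for a given no-installation profit `R`. On `ℝ × [0, ymax]` the
last case is `x ≥ x̄`. -/
def candidate (p : Params) (Ft : ℝ → ℝ) (R : ℝ → ℝ → ℝ) (x y : ℝ) : ℝ :=
  if (x, y) ∈ waiting p Ft ∪ Iio (xbar p Ft) ×ˢ {p.ymax} then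
    coeffA p Ft y * psi p (x + p.β * y) + R x y
  else if (x, y) ∈ installation₁ p Ft then
    coeffA p Ft (boundaryInv p Ft x) * psi p (x + p.β * boundaryInv p Ft x)
      + R x (boundaryInv p Ft x) - p.c * (boundaryInv p Ft x - y)
  else
    R x p.ymax - p.c * (p.ymax - y)

/-! ### Classical solutions -/

/-- `∂u/∂x`. -/
def dx (u : ℝ → ℝ → ℝ) (x y : ℝ) : ℝ := deriv (fun s => u s y) x

/-- `∂²u/∂x²`. -/
def dxx (u : ℝ → ℝ → ℝ) (x y : ℝ) : ℝ := deriv (fun s => dx u s y) x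

/-- `∂u/∂y` on `ℝ × [0, b]`, one-sided for `y = 0` and `y = b`. -/
def dy (b : ℝ) (u : ℝ → ℝ → ℝ) (x y : ℝ) : ℝ := derivWithin (fun t => u x t) (Icc 0 b) y

/-- `u ∈ C^{2,1}(ℝ × [0, b])`: the derivatives `u_x, u_xx, u_y` exist and, with `u`, are jointly
continuous on `ℝ × [0, b]`. -/
structure IsC21 (b : ℝ) (u : ℝ → ℝ → ℝ) : Prop where
  diff_x : ∀ x, ∀ y ∈ Icc 0 b, DifferentiableAt ℝ (fun s => u s y) x
  diff_xx : ∀ x, ∀ y ∈ Icc 0 b, DifferentiableAt ℝ (fun s => dx u s y) x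
  diff_y : ∀ x, ∀ y ∈ Icc 0 b, DifferentiableWithinAt ℝ (fun t => u x t) (Icc 0 b) y
  cont : ContinuousOn (fun q : ℝ × ℝ => u q.1 q.2) (univ ×ˢ Icc 0 b)
  cont_x : ContinuousOn (fun q : ℝ × ℝ => dx u q.1 q.2) (univ ×ˢ Icc 0 b)
  cont_xx : ContinuousOn (fun q : ℝ × ℝ => dxx u q.1 q.2) (univ ×ˢ Icc 0 b)
  cont_y : ContinuousOn (fun q : ℝ × ℝ => dy b u q.1 q.2) (univ ×ˢ Icc 0 b)

/-- The generator `ℒ^y u(x,y) = σ²/2 u_xx + κ ((μ - β y) - x) u_x`. -/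
def generator (p : Params) (u : ℝ → ℝ → ℝ) (x y : ℝ) : ℝ :=
  1 / 2 * p.σ ^ 2 * dxx u x y + p.κ * ((p.μ - p.β * y) - x) * dx u x y

end

end SolarInstallation

/-! In the waiting region the candidate is `A(t) ψ(x + βt) + R(x, t)`. The conditions `w_y = c` and
`w_xy = 0` on `x = F(t)` form a linear system for `A'` and `βA` with determinant `Q_0`. Its solution
gives the formula for `A`, and the requirement that the other unknown really be the derivative of
`A` is the differential equation of `F̃`.

All signs come from one fact: up to positive constants, `ψ^{(k)}` is the `k`-th moment of an
exponentially tilted positive measure on the half-line, so the Hankel determinants of orders 2 and 3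
are positive. Put `g = (ρ+κ)(c - R_y)` and `v = gψ' + ψ`; then `A` has the sign of `-v`. The
terminal condition says `v = 0`, which forces `D > 0` there, hence along the whole curve, since `D`
never vanishes on it. Where `v ≤ 0` the slope of `A` is negative, so `A ≥ 0` on `[0, ȳ]`. On `{v ≤
0, D > 0}` one has `N > D` (`ODEden_lt_ODEnum`): `N - D` is affine in `g`, and the delicate case is
a Turán-type inequality, which the equation of `ψ` turns into a Hankel determinant of order 3. Thus
`F' = β(N/D - 1) > 0`.

For existence, the vector field is `β(γ + η/χ)` with `χ = D/(ψQ_1)` and `γ, η > 0`. Truncating it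
near the pole `χ = 0` gives a globally solvable equation, and barrier arguments show that its
solution never feels the truncation (`exists_isShiftedBoundary`).

For the verification, `w(x, y)` is the waiting value at the level `max(y, F⁻¹(x))` minus the
installation cost (`candidate_eq`). As `w_y - c` and `w_xy` vanish on the boundary, two applications
of `hasDerivAt_envelope` give `w_x` and `w_xx`. Finally, `D > 0` means that `w_yxx < 0` on the
boundary, seen from the waiting side. This one sign gives both `w_y ≤ c` in the waiting region
(`waitY_le`) and `ℒw - ρw + xy ≤ 0` in the installation region (`installation_bracket`). -/

namespace SolarInstallation

open Filter Topology

/-! ### The expected profit in closed form -/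

section Profit

variable {Ω : Type*} [MeasurableSpace Ω] {P : Measure Ω} {W : ℝ≥0 → Ω → ℝ}

lemma tendsto_floor_grid {t : ℝ} (ht : 0 ≤ t) :
    Tendsto (fun n : ℕ => ((⌊t * n⌋₊ : ℝ) / n).toNNReal) atTop (𝓝 t.toNNReal) :=
  (continuous_real_toNNReal.tendsto t).comp
    ((tendsto_nat_floor_mul_div_atTop ht).comp tendsto_natCast_atTop_atTop)

/-- Each `W s` is only a.e. measurable and paths are only a.s. continuous. On the countable grid
`k/n` the variables can be replaced by measurable versions off a single null set; path continuity
then exhibits `W` as an a.e. limit of jointly measurable step processes. -/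
lemma aestronglyMeasurable_uncurry_of_brownian (hW : IsBrownianReal W P) [SFinite P]
    (ν : Measure ℝ) [SFinite ν] (hν : ∀ᵐ t ∂ν, 0 ≤ t) :
    AEStronglyMeasurable (fun q : ℝ × Ω => W q.1.toNNReal q.2) (ν.prod P) := by
  have hm : ∀ s : ℝ≥0, AEMeasurable (W s) P := hW.aemeasurable
  let V : ℝ≥0 → Ω → ℝ := fun s => (hm s).mk (W s)
  let S : ℕ → ℕ → ℝ≥0 := fun n k => ((k : ℝ) / n).toNNReal
  have hV : ∀ᵐ ω ∂P, (∀ n k, W (S n k) ω = V (S n k) ω) ∧ Continuous (W · ω) := by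
    refine Filter.Eventually.and ?_ hW.cont
    exact ae_all_iff.2 fun n => ae_all_iff.2 fun k => (hm _).ae_eq_mk
  have hV' : ∀ᵐ q ∂(ν.prod P), (∀ n k, W (S n k) q.2 = V (S n k) q.2) ∧
      Continuous (W · q.2) :=
    Measure.quasiMeasurePreserving_snd.ae hV
  have hν' : ∀ᵐ q ∂(ν.prod P), 0 ≤ q.1 := Measure.quasiMeasurePreserving_fst.ae hν
  refine (aemeasurable_of_tendsto_metrizable_ae
    (f := fun n (q : ℝ × Ω) => V (S n ⌊q.1 * n⌋₊) q.2) atTop (fun n => ?_) ?_).aestronglyMeasurable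
  · have h1 : Measurable (fun q : ℕ × Ω => V (S n q.1) q.2) :=
      measurable_from_prod_countable_right fun k => (hm (S n k)).measurable_mk
    have h2 : Measurable (fun q : ℝ × Ω => ((⌊q.1 * n⌋₊, q.2) : ℕ × Ω)) :=
      (Nat.measurable_floor.comp (measurable_fst.mul_const _)).prodMk measurable_snd
    exact (h1.comp h2).aemeasurable
  · filter_upwards [hV', hν'] with q hq hq0
    simp_rw [← hq.1]
    exact (hq.2.tendsto _).comp (tendsto_floor_grid hq0)

lemma integral_abs_brownian_le (hW : IsBrownianReal W P) [IsProbabilityMeasure P] (s : ℝ≥0) :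
    ∫ ω, |W s ω| ∂P ≤ 1 + s := by
  have hL2 : MemLp (W s) 2 P := (hW.isGaussianProcess.hasGaussianLaw_eval s).memLp_two
  have hsq : ∫ ω, W s ω ^ 2 ∂P = s := by
    have h1 := hW.covariance_eval s s
    rw [covariance_self (hW.aemeasurable s), variance_of_integral_eq_zero (hW.aemeasurable s)
      (hW.integral_eval s)] at h1
    simpa using h1
  have h2 : Integrable (fun ω => 1 + W s ω ^ 2) P := (integrable_const _).add hL2.integrable_sq
  calc ∫ ω, |W s ω| ∂P ≤ ∫ ω, (1 + W s ω ^ 2) ∂P :=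
        integral_mono (hW.integrable_eval s).abs h2 fun ω => by
          simp only
          nlinarith [sq_abs (W s ω), sq_nonneg (|W s ω| - 1), abs_nonneg (W s ω)]
    _ = 1 + s := by
        rw [integral_add (integrable_const _) hL2.integrable_sq, hsq]; simp

lemma integrableOn_exp_mul_one_add {ρ : ℝ} (hρ : 0 < ρ) :
    IntegrableOn (fun t : ℝ => Real.exp (-ρ * t) * (1 + t)) (Ioi 0) := by
  have h0 := integrableOn_exp_mul_Ioi (a := -ρ) (by linarith) 0
  have h1 := integrableOn_rpow_mul_exp_neg_mul_rpow (p := 1) (s := 1) (b := ρ)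
    (by norm_num) (by norm_num) hρ
  simp only [Real.rpow_one] at h1
  refine (h0.add h1).congr_fun (fun t _ => ?_) measurableSet_Ioi
  simp only [Pi.add_apply]
  ring

lemma integrable_discounted_brownian (hW : IsBrownianReal W P) [IsProbabilityMeasure P]
    {ρ : ℝ} (hρ : 0 < ρ) :
    Integrable (fun q : ℝ × Ω => Real.exp (-ρ * q.1) * W q.1.toNNReal q.2)
      ((volume.restrict (Ioi (0 : ℝ))).prod P) := by
  have hpos : ∀ᵐ t ∂(volume.restrict (Ioi (0 : ℝ))), 0 ≤ t :=
    (ae_restrict_mem measurableSet_Ioi).mono fun t ht => le_of_lt ht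
  have hmeas : AEStronglyMeasurable (fun q : ℝ × Ω => Real.exp (-ρ * q.1) * W q.1.toNNReal q.2)
      ((volume.restrict (Ioi (0 : ℝ))).prod P) := by
    refine AEStronglyMeasurable.mul ?_ (aestronglyMeasurable_uncurry_of_brownian hW _ hpos)
    exact Measurable.aestronglyMeasurable (by fun_prop)
  refine (integrable_prod_iff hmeas).2 ⟨ae_of_all _ fun t =>
    (hW.integrable_eval t.toNNReal).const_mul (Real.exp (-ρ * t)), ?_⟩
  refine (integrableOn_exp_mul_one_add hρ).mono' hmeas.norm.integral_prod_right' ?_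
  filter_upwards [hpos] with t ht
  rw [Real.norm_of_nonneg (integral_nonneg fun _ => norm_nonneg _)]
  simp_rw [norm_mul, Real.norm_eq_abs, Real.abs_exp, integral_const_mul]
  gcongr
  simpa [ht] using integral_abs_brownian_le hW t.toNNReal

/-- Fubini, then `E[W t] = 0`. -/
lemma integral_discounted_brownian (hW : IsBrownianReal W P) [IsProbabilityMeasure P]
    {ρ : ℝ} (hρ : 0 < ρ) :
    ∫ ω, (∫ t in Ioi (0 : ℝ), Real.exp (-ρ * t) * W t.toNNReal ω) ∂P = 0 := by
  rw [← integral_integral_swap (f := fun t ω => Real.exp (-ρ * t) * W t.toNNReal ω)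
    (integrable_discounted_brownian hW hρ)]
  simp_rw [integral_const_mul]
  simp [hW.integral_eval]

/-- Discounted integral of a continuous solution of the linear integral equation
`z_t = x + ∫₀ᵗ κ (m - z_s) ds + σ w_t`. -/
lemma integral_discounted_of_linear_eq {κ ρ σ x m : ℝ} (hκ : 0 < κ) (hρ : 0 < ρ) {z w : ℝ≥0 → ℝ}
    (hz : Continuous z) (hw : Continuous w)
    (hint : IntegrableOn (fun t : ℝ => Real.exp (-ρ * t) * w t.toNNReal) (Ioi 0))
    (heq : ∀ t : ℝ≥0, z t = x + (∫ s in (0 : ℝ)..(t : ℝ), κ * (m - z s.toNNReal)) + σ * w t) :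
    ∫ t in Ioi (0 : ℝ), Real.exp (-ρ * t) * z t.toNNReal =
      x / (ρ + κ) + κ * m / (ρ * (ρ + κ)) +
        σ * ρ / (ρ + κ) * ∫ t in Ioi (0 : ℝ), Real.exp (-ρ * t) * w t.toNNReal := by
  set J : ℝ → ℝ := fun t => ∫ s in (0 : ℝ)..t, κ * (m - z s.toNNReal) with hJ
  set f : ℝ → ℝ := fun t => m - x - σ * w t.toNNReal with hf
  have hzc : Continuous fun s : ℝ => z s.toNNReal := hz.comp continuous_real_toNNReal
  have hwc : Continuous fun s : ℝ => w s.toNNReal := hw.comp continuous_real_toNNReal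
  have hfc : Continuous f := continuous_const.sub (continuous_const.mul hwc)
  have hz' : ∀ t : ℝ, 0 ≤ t → z t.toNNReal = x + J t + σ * w t.toNNReal := fun t ht => by
    rw [heq t.toNNReal, Real.coe_toNNReal t ht]
  have hJd : ∀ t, HasDerivAt J (κ * (m - z t.toNNReal)) t := fun t =>
    (Continuous.integral_hasStrictDerivAt (by fun_prop) 0 t).hasDerivAt
  have hJ0 : J 0 = 0 := by simp [hJ]
  -- The drift integral satisfies `J' = κ(f - J)`. Variation of constants writes `e^{-ρt} J` as the
  -- convolution of `e^{-ρs} f(s)` with `κ e^{-(ρ+κ)u}`, so its integrability and its integral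
  -- follow from those of the factors, with no a priori bound on `z`.
  have hJconv : ∀ t : ℝ, 0 ≤ t → Real.exp (-ρ * t) * J t =
      ∫ s in (0 : ℝ)..t, (Real.exp (-ρ * s) * f s) * (κ * Real.exp (-(ρ + κ) * (t - s))) := by
    intro t ht
    have h1 : ∫ s in (0 : ℝ)..t, κ * Real.exp (κ * s) * f s =
        Real.exp (κ * t) * J t - Real.exp (κ * 0) * J 0 := by
      refine intervalIntegral.integral_eq_sub_of_hasDerivAt (f := fun s => Real.exp (κ * s) * J s)
        (fun s hs => ?_) (Continuous.intervalIntegrable (by fun_prop) _ _)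
      rw [uIcc_of_le ht] at hs
      have h2 : HasDerivAt (fun s => Real.exp (κ * s)) (Real.exp (κ * s) * κ) s := by
        simpa using ((hasDerivAt_id s).const_mul κ).exp
      refine (h2.mul (hJd s)).congr_deriv ?_
      rw [hz' s hs.1]
      simp only [hf]
      ring
    rw [hJ0, mul_zero, sub_zero] at h1
    have h3 : ∀ s, (Real.exp (-ρ * s) * f s) * (κ * Real.exp (-(ρ + κ) * (t - s))) =
        Real.exp (-(ρ + κ) * t) * (κ * Real.exp (κ * s) * f s) := fun s => by
      have : Real.exp (-ρ * s) * Real.exp (-(ρ + κ) * (t - s)) =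
          Real.exp (-(ρ + κ) * t) * Real.exp (κ * s) := by
        rw [← Real.exp_add, ← Real.exp_add]; congr 1; ring
      linear_combination f s * κ * this
    simp_rw [h3]
    rw [intervalIntegral.integral_const_mul, h1, ← mul_assoc, ← Real.exp_add]
    congr 2; ring
  have hE0 : ∀ a : ℝ, 0 < a → ∫ t in Ioi (0 : ℝ), Real.exp (-a * t) = 1 / a := fun a ha => by
    rw [integral_exp_mul_Ioi (by linarith)]; simp
  have hEi : ∀ a : ℝ, 0 < a → IntegrableOn (fun t : ℝ => Real.exp (-a * t)) (Ioi 0) := fun a ha =>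
    integrableOn_exp_mul_Ioi (by linarith) 0
  have hfi : IntegrableOn (fun t => Real.exp (-ρ * t) * f t) (Ioi 0) := by
    refine IntegrableOn.congr_fun (((hEi ρ hρ).const_mul (m - x)).sub (hint.const_mul σ))
      (fun t _ => ?_) measurableSet_Ioi
    simp only [hf, Pi.sub_apply]; ring
  have hfI : ∫ t in Ioi (0 : ℝ), Real.exp (-ρ * t) * f t =
      (m - x) / ρ - σ * ∫ t in Ioi (0 : ℝ), Real.exp (-ρ * t) * w t.toNNReal := by
    have : ∀ t, Real.exp (-ρ * t) * f t =
        (m - x) * Real.exp (-ρ * t) - σ * (Real.exp (-ρ * t) * w t.toNNReal) := fun t => by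
      simp only [hf]; ring
    simp_rw [this]
    rw [integral_sub ((hEi ρ hρ).const_mul _) (hint.const_mul σ), integral_const_mul,
      integral_const_mul, hE0 ρ hρ]
    ring
  have hρκ : 0 < ρ + κ := by linarith
  have hki : IntegrableOn (fun t : ℝ => κ * Real.exp (-(ρ + κ) * t)) (Ioi 0) :=
    (hEi _ hρκ).const_mul κ
  have hJI : ∫ t in Ioi (0 : ℝ), Real.exp (-ρ * t) * J t =
      (∫ t in Ioi (0 : ℝ), Real.exp (-ρ * t) * f t) * (κ / (ρ + κ)) := by
    have := integral_posConvolution hfi hki (ContinuousLinearMap.mul ℝ ℝ)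
    simp only [ContinuousLinearMap.mul_apply'] at this
    rw [integral_const_mul, hE0 _ hρκ] at this
    rw [setIntegral_congr_fun measurableSet_Ioi fun t ht => hJconv t (le_of_lt ht), this]
    ring
  have hJi : IntegrableOn (fun t => Real.exp (-ρ * t) * J t) (Ioi 0) := by
    have := (integrable_posConvolution hfi hki (ContinuousLinearMap.mul ℝ ℝ)).integrableOn
      (s := Ioi 0)
    refine this.congr_fun (fun t ht => ?_) measurableSet_Ioi
    simp only [posConvolution, indicator_of_mem ht, ContinuousLinearMap.mul_apply']
    exact (hJconv t (le_of_lt ht)).symm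
  have hsplit : ∀ t ∈ Ioi (0 : ℝ), Real.exp (-ρ * t) * z t.toNNReal =
      x * Real.exp (-ρ * t) + Real.exp (-ρ * t) * J t +
        σ * (Real.exp (-ρ * t) * w t.toNNReal) := fun t ht => by
    rw [hz' t (le_of_lt ht)]; ring
  rw [setIntegral_congr_fun measurableSet_Ioi hsplit,
    integral_add (f := fun t => x * Real.exp (-ρ * t) + Real.exp (-ρ * t) * J t)
      (((hEi ρ hρ).const_mul _).add hJi) (hint.const_mul σ),
    integral_add ((hEi ρ hρ).const_mul _) hJi, integral_const_mul, integral_const_mul, hJI, hfI,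
    hE0 ρ hρ]
  field_simp
  ring

/-- Closed form of the expected discounted profit. -/
noncomputable def profit (p : Params) (x y : ℝ) : ℝ :=
  y * (x / (p.ρ + p.κ) + p.κ * (p.μ - p.β * y) / (p.ρ * (p.ρ + p.κ)))

/-- The discounted integral is computed path by path; the only random term is a multiple of the
discounted Brownian integral, which has mean zero. -/
lemma R_eq_profit (hW : IsBrownianReal W P) {p : Params} (hp : p.Admissible)
    {X : ℝ → ℝ → ℝ≥0 → Ω → ℝ} {x y : ℝ} (hX : IsPriceProcess P W p x y (X x y)) :
    R P X p x y = profit p x y := by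
  have hP : IsProbabilityMeasure P := (hW.hasLaw_eval 0).isProbabilityMeasure
  have hi := integrable_discounted_brownian hW hp.ρ_pos
  have hae : (fun ω => ∫ t in Ioi (0 : ℝ), Real.exp (-p.ρ * t) * X x y t.toNNReal ω * y) =ᵐ[P]
      fun ω => profit p x y + y * (p.σ * p.ρ / (p.ρ + p.κ)) *
        ∫ t in Ioi (0 : ℝ), Real.exp (-p.ρ * t) * W t.toNNReal ω := by
    filter_upwards [hX, hW.cont, hi.prod_left_ae] with ω h1 h2 h3
    rw [integral_mul_const, integral_discounted_of_linear_eq hp.κ_pos hp.ρ_pos h1.1 h2 h3 h1.2,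
      profit]
    ring
  rw [R, integral_congr_ae hae, integral_add (integrable_const _)
    (hi.integral_prod_right.const_mul _), integral_const_mul,
    integral_discounted_brownian hW hp.ρ_pos]
  simp

end Profit

/-! ### Moments of the tilted Gamma-Gaussian measure -/

section Moments

/-- The density `t^(ν-1) exp(-t²/2)`. -/
noncomputable def tiltDensity (ν t : ℝ) : ℝ := t ^ (ν - 1) * Real.exp (-t ^ 2 / 2)

/-- The measure with density `t^(ν-1) exp(-t²/2)` on the half-line. -/
noncomputable def tiltMeasure (ν : ℝ) : Measure ℝ :=
  (volume.restrict (Ioi (0 : ℝ))).withDensity fun t => ENNReal.ofReal (tiltDensity ν t)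

/-- `∫₀^∞ t^n exp(s t) t^(ν-1) exp(-t²/2) dt`. -/
noncomputable def moment (ν : ℝ) (n : ℕ) (s : ℝ) : ℝ :=
  ∫ t, t ^ n * Real.exp (s * t) ∂(tiltMeasure ν)

lemma measurable_tiltDensity (ν : ℝ) : Measurable (tiltDensity ν) := by
  unfold tiltDensity; fun_prop

lemma tiltDensity_pos (ν : ℝ) {t : ℝ} (ht : 0 < t) : 0 < tiltDensity ν t := by
  unfold tiltDensity; positivity

lemma integral_tiltMeasure (ν : ℝ) (g : ℝ → ℝ) :
    ∫ t, g t ∂(tiltMeasure ν) = ∫ t in Ioi (0 : ℝ), tiltDensity ν t * g t := by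
  rw [tiltMeasure, integral_withDensity_eq_integral_toReal_smul
    (measurable_tiltDensity ν).ennreal_ofReal (ae_of_all _ fun _ => ENNReal.ofReal_lt_top)]
  refine setIntegral_congr_fun measurableSet_Ioi fun t ht => ?_
  simp [ENNReal.toReal_ofReal (tiltDensity_pos ν ht).le]

lemma integrable_tiltMeasure_iff (ν : ℝ) (g : ℝ → ℝ) :
    Integrable g (tiltMeasure ν) ↔
      IntegrableOn (fun t => tiltDensity ν t * g t) (Ioi (0 : ℝ)) := by
  rw [tiltMeasure, integrable_withDensity_iff_integrable_smul'
    (measurable_tiltDensity ν).ennreal_ofReal (ae_of_all _ fun _ => ENNReal.ofReal_lt_top)]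
  refine integrableOn_congr_fun (fun t ht => ?_) measurableSet_Ioi
  simp [ENNReal.toReal_ofReal (tiltDensity_pos ν ht).le]

lemma integrable_exp_tiltMeasure {ν : ℝ} (hν : 0 < ν) (s : ℝ) :
    Integrable (fun t => Real.exp (s * t)) (tiltMeasure ν) := by
  rw [integrable_tiltMeasure_iff]
  have h := (integrableOn_rpow_mul_exp_neg_mul_sq (b := 1 / 4) (by norm_num)
    (s := ν - 1) (by linarith)).const_mul (Real.exp (s ^ 2))
  refine Integrable.mono' h
    ((measurable_tiltDensity ν).mul (by fun_prop)).aestronglyMeasurable ?_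
  filter_upwards [ae_restrict_mem measurableSet_Ioi] with t ht
  have ht' : (0 : ℝ) < t := ht
  rw [Real.norm_of_nonneg (mul_pos (tiltDensity_pos ν ht) (Real.exp_pos _)).le, tiltDensity,
    mul_assoc, ← Real.exp_add, mul_left_comm, ← Real.exp_add]
  refine mul_le_mul_of_nonneg_left (Real.exp_le_exp.2 ?_) (Real.rpow_nonneg ht'.le _)
  -- Completing the square: `-t²/2 + st ≤ s² - t²/4`.
  nlinarith [sq_nonneg (t / 2 - s)]

lemma mem_interior_integrableExpSet_tiltMeasure {ν : ℝ} (hν : 0 < ν) (s : ℝ) :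
    s ∈ interior (integrableExpSet id (tiltMeasure ν)) := by
  have : integrableExpSet id (tiltMeasure ν) = univ :=
    eq_univ_of_forall fun s => integrable_exp_tiltMeasure hν s
  simp [this]

lemma integrable_pow_exp_tiltMeasure {ν : ℝ} (hν : 0 < ν) (n : ℕ) (s : ℝ) :
    Integrable (fun t => t ^ n * Real.exp (s * t)) (tiltMeasure ν) :=
  integrable_pow_mul_exp_of_mem_interior_integrableExpSet (X := id)
    (mem_interior_integrableExpSet_tiltMeasure hν s) n

lemma hasDerivAt_moment {ν : ℝ} (hν : 0 < ν) (n : ℕ) (s : ℝ) :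
    HasDerivAt (moment ν n) (moment ν (n + 1) s) s :=
  hasDerivAt_integral_pow_mul_exp_real (X := id)
    (mem_interior_integrableExpSet_tiltMeasure hν s) n

/-- Strict positivity is asked only beyond a threshold `l`, so that squares of polynomials with
zeros in the half-line are admitted. -/
lemma integral_tiltMeasure_pos {ν : ℝ} {g : ℝ → ℝ} (l : ℝ) (hg : Integrable g (tiltMeasure ν))
    (h0 : ∀ t, 0 < t → 0 ≤ g t) (h1 : ∀ t, 0 < t → l < t → 0 < g t) :
    0 < ∫ t, g t ∂(tiltMeasure ν) := by
  rw [integrable_tiltMeasure_iff] at hg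
  rw [integral_tiltMeasure, setIntegral_pos_iff_support_of_nonneg_ae _ hg]
  · have hsub : Ioo (max l 0) (max l 0 + 1) ⊆
        Function.support (fun t => tiltDensity ν t * g t) ∩ Ioi 0 := fun t ht => by
      have ht0 : 0 < t := (le_max_right _ _).trans_lt ht.1
      exact ⟨(mul_pos (tiltDensity_pos ν ht0) (h1 t ht0 ((le_max_left _ _).trans_lt ht.1))).ne',
        ht0⟩
    refine lt_of_lt_of_le ?_ (measure_mono hsub)
    simp
  · filter_upwards [ae_restrict_mem measurableSet_Ioi] with t ht
    exact mul_nonneg (tiltDensity_pos ν ht).le (h0 t ht)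

lemma moment_pos {ν : ℝ} (hν : 0 < ν) (n : ℕ) (s : ℝ) : 0 < moment ν n s :=
  integral_tiltMeasure_pos 0 (integrable_pow_exp_tiltMeasure hν n s)
    (fun t ht => by positivity) fun t ht _ => by positivity

/-- Strict Cauchy–Schwarz: expand the positive integral of `t^n (t - l)² e^{st}`, with `l` the
quotient of the moments of orders `n + 1` and `n`. -/
lemma moment_sq_lt {ν : ℝ} (hν : 0 < ν) (n : ℕ) (s : ℝ) :
    moment ν (n + 1) s ^ 2 < moment ν n s * moment ν (n + 2) s := by
  have h0 := moment_pos hν n s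
  set l := moment ν (n + 1) s / moment ν n s with hl
  have hI := integrable_pow_exp_tiltMeasure hν
  have hsplit : ∀ t : ℝ, t ^ n * (t - l) ^ 2 * Real.exp (s * t) =
      t ^ (n + 2) * Real.exp (s * t) - 2 * l * (t ^ (n + 1) * Real.exp (s * t))
        + l ^ 2 * (t ^ n * Real.exp (s * t)) := fun t => by ring
  have hi : Integrable (fun t => t ^ (n + 2) * Real.exp (s * t)
      - 2 * l * (t ^ (n + 1) * Real.exp (s * t))) (tiltMeasure ν) :=
    (hI (n + 2) s).sub ((hI (n + 1) s).const_mul _)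
  have hi' := hi.add ((hI n s).const_mul (l ^ 2))
  have hpos : 0 < ∫ t, t ^ n * (t - l) ^ 2 * Real.exp (s * t) ∂(tiltMeasure ν) := by
    refine integral_tiltMeasure_pos l ?_ (fun t ht => by positivity) fun t ht hlt => ?_
    · simp_rw [hsplit]; exact hi'
    · have : 0 < t - l := by linarith
      positivity
  have heq : ∫ t, t ^ n * (t - l) ^ 2 * Real.exp (s * t) ∂(tiltMeasure ν) =
      moment ν (n + 2) s - 2 * l * moment ν (n + 1) s + l ^ 2 * moment ν n s := by
    simp_rw [hsplit]
    rw [integral_add hi ((hI n s).const_mul _),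
      integral_sub (hI (n + 2) s) ((hI (n + 1) s).const_mul _), integral_const_mul,
      integral_const_mul]
    rfl
  rw [heq] at hpos
  have : moment ν (n + 1) s = l * moment ν n s := by rw [hl]; field_simp
  rw [this] at hpos ⊢
  nlinarith

/-- Positivity of the `3 × 3` Hankel determinants of the moments. -/
lemma moment_hankel_pos {ν : ℝ} (hν : 0 < ν) (n : ℕ) (s : ℝ) :
    0 < moment ν (n + 4) s * (moment ν n s * moment ν (n + 2) s - moment ν (n + 1) s ^ 2)
      - moment ν (n + 3) s * (moment ν n s * moment ν (n + 3) s
        - moment ν (n + 1) s * moment ν (n + 2) s)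
      + moment ν (n + 2) s * (moment ν (n + 1) s * moment ν (n + 3) s
        - moment ν (n + 2) s ^ 2) := by
  -- `(a, b, c)` are the cofactors of the last row of the Hankel matrix. The matrix sends this
  -- vector to `(0, 0, det)`, so the quadratic form, the integral of `t^n (a + bt + ct²)² e^{st}`,
  -- equals `c · det`.
  set c : ℝ := moment ν n s * moment ν (n + 2) s - moment ν (n + 1) s ^ 2 with hc
  set b : ℝ := -(moment ν n s * moment ν (n + 3) s - moment ν (n + 1) s * moment ν (n + 2) s)
    with hb
  set a : ℝ := moment ν (n + 1) s * moment ν (n + 3) s - moment ν (n + 2) s ^ 2 with ha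
  have hc0 : 0 < c := by linarith [moment_sq_lt hν n s]
  let e : ℕ → ℝ → ℝ := fun j t => t ^ (n + j) * Real.exp (s * t)
  have hI : ∀ j, Integrable (e j) (tiltMeasure ν) := fun j =>
    integrable_pow_exp_tiltMeasure hν (n + j) s
  let coef : Fin 5 → ℝ := ![a ^ 2, 2 * a * b, b ^ 2 + 2 * a * c, 2 * b * c, c ^ 2]
  have hsplit : ∀ t : ℝ, t ^ n * (a + b * t + c * t ^ 2) ^ 2 * Real.exp (s * t) =
      ∑ j : Fin 5, coef j * e j t := fun t => by
    simp only [Fin.sum_univ_five, coef, e]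
    simp
    ring
  have hpos : 0 < ∫ t, t ^ n * (a + b * t + c * t ^ 2) ^ 2 * Real.exp (s * t)
      ∂(tiltMeasure ν) := by
    -- Beyond this threshold the leading term dominates and the polynomial is positive.
    refine integral_tiltMeasure_pos (1 + (|a| + |b|) / c) ?_ (fun t ht => by positivity)
      fun t ht hlt => ?_
    · simp_rw [hsplit]
      exact integrable_finsetSum _ fun j _ => (hI j).const_mul _
    · have h1 : 1 < t := by
        have : 0 ≤ (|a| + |b|) / c := by positivity
        linarith
      have h2 : |a| + |b| < c * t := by
        rw [← div_lt_iff₀' hc0]; linarith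
      have h3 : 0 < a + b * t + c * t ^ 2 := by
        have h4 : (|a| + |b|) * t < c * t * t := mul_lt_mul_of_pos_right h2 ht
        nlinarith [neg_abs_le a, neg_abs_le b, abs_nonneg a,
          mul_le_mul_of_nonneg_right (neg_abs_le b) ht.le,
          mul_le_mul_of_nonneg_left h1.le (abs_nonneg a)]
      positivity
  have heq : ∫ t, t ^ n * (a + b * t + c * t ^ 2) ^ 2 * Real.exp (s * t) ∂(tiltMeasure ν) =
      ∑ j : Fin 5, coef j * moment ν (n + j) s := by
    simp_rw [hsplit]
    rw [integral_finsetSum (f := fun (j : Fin 5) t => coef j * e j t) _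
      fun j _ => (hI j).const_mul _]
    refine Finset.sum_congr rfl fun j _ => ?_
    rw [integral_const_mul]
    rfl
  rw [heq] at hpos
  simp only [Fin.sum_univ_five, coef] at hpos
  simp only [Fin.isValue, Matrix.cons_val_zero, Fin.val_zero, add_zero, Matrix.cons_val_one,
    Fin.val_one, Matrix.cons_val, Fin.val_two] at hpos
  refine pos_of_mul_pos_right (a := c) (hpos.trans_eq ?_) hc0.le
  simp only [show ((3 : Fin 5) : ℕ) = 3 from rfl, show ((4 : Fin 5) : ℕ) = 4 from rfl]
  rw [ha, hb, hc]
  ring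

/-- The integral of the derivative of `t^ν e^{-t²/2 + st}` over the half-line vanishes. This
recurrence becomes the differential equation of `ψ`. -/
lemma moment_two {ν : ℝ} (hν : 0 < ν) (s : ℝ) :
    moment ν 2 s = s * moment ν 1 s + ν * moment ν 0 s := by
  have hI := integrable_pow_exp_tiltMeasure hν
  let u : ℝ → ℝ := fun t => t ^ ν * (Real.exp (-t ^ 2 / 2) * Real.exp (s * t))
  let v : ℝ → ℝ := fun t => ν * (t ^ 0 * Real.exp (s * t)) + s * (t ^ 1 * Real.exp (s * t))
    - t ^ 2 * Real.exp (s * t)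
  have hv : Integrable v (tiltMeasure ν) :=
    (((hI 0 s).const_mul ν).add ((hI 1 s).const_mul s)).sub (hI 2 s)
  have hv' := (integrable_tiltMeasure_iff ν v).1 hv
  have hrp : ∀ t : ℝ, 0 < t → t ^ ν = t ^ (ν - 1) * t := fun t ht => by
    rw [Real.rpow_sub_one ht.ne']; field_simp
  have hu' : IntegrableOn u (Ioi 0) := by
    refine IntegrableOn.congr_fun ((integrable_tiltMeasure_iff ν _).1 (hI 1 s)) (fun t ht => ?_)
      measurableSet_Ioi
    simp only [u, tiltDensity, hrp t ht]; ring
  have hd : ∀ t ∈ Ioi (0 : ℝ), HasDerivAt u (tiltDensity ν t * v t) t := fun t ht => by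
    have ht' : (0 : ℝ) < t := ht
    have h1 := Real.hasDerivAt_rpow_const (x := t) (p := ν) (Or.inl ht'.ne')
    have h2 : HasDerivAt (fun t : ℝ => Real.exp (-t ^ 2 / 2))
        (Real.exp (-t ^ 2 / 2) * (-(2 * t) / 2)) t := by
      simpa using (((hasDerivAt_id t).pow 2).neg.div_const 2).exp
    have h3 : HasDerivAt (fun t : ℝ => Real.exp (s * t)) (Real.exp (s * t) * s) t := by
      simpa using ((hasDerivAt_id t).const_mul s).exp
    refine (h1.mul (h2.mul h3)).congr_deriv ?_
    simp only [v, tiltDensity, hrp t ht', Pi.mul_apply]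
    ring
  have hcont : ContinuousWithinAt u (Ici 0) 0 := by
    refine Continuous.continuousWithinAt ?_
    have : Continuous fun t : ℝ => t ^ ν := Real.continuous_rpow_const hν.le
    fun_prop
  have hlim := tendsto_zero_of_hasDerivAt_of_integrableOn_Ioi hd hv' hu'
  have hfin := integral_Ioi_of_hasDerivAt_of_tendsto hcont hd hv' hlim
  rw [← integral_tiltMeasure ν v] at hfin
  have hu0 : u 0 = 0 := by simp [u, Real.zero_rpow hν.ne']
  have heq : ∫ t, v t ∂(tiltMeasure ν) =
      ν * moment ν 0 s + s * moment ν 1 s - moment ν 2 s := by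
    have h1 : Integrable (fun t : ℝ => ν * (t ^ 0 * Real.exp (s * t))
        + s * (t ^ 1 * Real.exp (s * t))) (tiltMeasure ν) :=
      ((hI 0 s).const_mul ν).add ((hI 1 s).const_mul s)
    simp only [v]
    rw [integral_sub h1 (hI 2 s), integral_add ((hI 0 s).const_mul _) ((hI 1 s).const_mul _),
      integral_const_mul, integral_const_mul]
    rfl
  rw [heq, hu0] at hfin
  linarith

end Moments

/-! ### The derivatives of the fundamental solution -/

section Psi

variable {p : Params}

/-- The Gaussian prefactors of `ψ` and of the cylinder function cancel. -/
lemma psi_eq_moment (hp : p.Admissible) (x : ℝ) :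
    psi p x = (Real.Gamma (p.ρ / p.κ))⁻¹ *
      moment (p.ρ / p.κ) 0 (√(2 * p.κ) / p.σ * (x - p.μ)) := by
  have hκ := hp.κ_pos
  have hσ := hp.σ_pos
  have hsq : √(2 * p.κ) ^ 2 = 2 * p.κ := Real.sq_sqrt (by positivity)
  have hexp : Real.exp (p.κ * (x - p.μ) ^ 2 / (2 * p.σ ^ 2)) *
      Real.exp (-(-((x - p.μ) / p.σ) * √(2 * p.κ)) ^ 2 / 4) = 1 := by
    rw [← Real.exp_add, Real.exp_eq_one_iff]
    have : -(-((x - p.μ) / p.σ) * √(2 * p.κ)) ^ 2 / 4 =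
        -(((x - p.μ) / p.σ) ^ 2 * √(2 * p.κ) ^ 2) / 4 := by ring
    rw [this, hsq]
    field_simp
    ring
  have hint : (∫ t in Ioi (0 : ℝ), t ^ (-(-p.ρ / p.κ) - 1) *
      Real.exp (-t ^ 2 / 2 - -((x - p.μ) / p.σ) * √(2 * p.κ) * t)) =
      moment (p.ρ / p.κ) 0 (√(2 * p.κ) / p.σ * (x - p.μ)) := by
    rw [moment, integral_tiltMeasure]
    refine setIntegral_congr_fun measurableSet_Ioi fun t _ => ?_
    simp only [tiltDensity, pow_zero, one_mul]
    rw [mul_assoc (t ^ (p.ρ / p.κ - 1)), ← Real.exp_add, neg_div, neg_neg]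
    congr 2
    ring
  rw [psi, cylinderD, hint, ← mul_assoc, ← mul_div_assoc, hexp, neg_div, neg_neg, one_div]

lemma psiD_eq_moment (hp : p.Admissible) (k : ℕ) :
    psiD p k = fun x => (Real.Gamma (p.ρ / p.κ))⁻¹ * ((√(2 * p.κ) / p.σ) ^ k *
      moment (p.ρ / p.κ) k (√(2 * p.κ) / p.σ * (x - p.μ))) := by
  induction k with
  | zero =>
    funext x
    simp [psiD, psi_eq_moment hp]
  | succ k ih =>
    funext x
    have hν : 0 < p.ρ / p.κ := div_pos hp.ρ_pos hp.κ_pos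
    have h1 : HasDerivAt (fun x => √(2 * p.κ) / p.σ * (x - p.μ)) (√(2 * p.κ) / p.σ) x := by
      simpa using ((hasDerivAt_id x).sub_const p.μ).const_mul (√(2 * p.κ) / p.σ)
    have h2 := (((hasDerivAt_moment hν k _).comp x h1).const_mul
      ((√(2 * p.κ) / p.σ) ^ k)).const_mul (Real.Gamma (p.ρ / p.κ))⁻¹
    have h3 : psiD p (k + 1) x = deriv (psiD p k) x := by
      simp only [psiD, iteratedDeriv_succ]; rfl
    rw [h3, ih]
    refine h2.deriv.trans ?_
    ring

lemma hasDerivAt_psiD (hp : p.Admissible) (k : ℕ) (x : ℝ) :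
    HasDerivAt (psiD p k) (psiD p (k + 1) x) x := by
  have hν : 0 < p.ρ / p.κ := div_pos hp.ρ_pos hp.κ_pos
  have h1 : HasDerivAt (fun x => √(2 * p.κ) / p.σ * (x - p.μ)) (√(2 * p.κ) / p.σ) x := by
    simpa using ((hasDerivAt_id x).sub_const p.μ).const_mul (√(2 * p.κ) / p.σ)
  have h2 := (((hasDerivAt_moment hν k _).comp x h1).const_mul
    ((√(2 * p.κ) / p.σ) ^ k)).const_mul (Real.Gamma (p.ρ / p.κ))⁻¹
  rw [psiD_eq_moment hp k, psiD_eq_moment hp (k + 1)]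
  refine h2.congr_deriv ?_
  ring

lemma psiD_zero : psiD p 0 = psi p := by
  funext x; simp [psiD]

lemma psiD_pos (hp : p.Admissible) (k : ℕ) (x : ℝ) : 0 < psiD p k x := by
  have hν : 0 < p.ρ / p.κ := div_pos hp.ρ_pos hp.κ_pos
  have := moment_pos hν k (√(2 * p.κ) / p.σ * (x - p.μ))
  have := Real.Gamma_pos_of_pos hν
  have := hp.κ_pos
  have := hp.σ_pos
  rw [psiD_eq_moment hp]
  positivity

lemma Q_pos (hp : p.Admissible) (k : ℕ) (x : ℝ) : 0 < Q p k x := by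
  have hν : 0 < p.ρ / p.κ := div_pos hp.ρ_pos hp.κ_pos
  have h1 := moment_sq_lt hν k (√(2 * p.κ) / p.σ * (x - p.μ))
  have h2 := Real.Gamma_pos_of_pos hν
  have h3 := hp.κ_pos
  have h4 := hp.σ_pos
  have ha : 0 < √(2 * p.κ) / p.σ := by positivity
  simp only [Q, psiD_eq_moment hp]
  set a := √(2 * p.κ) / p.σ
  have : 0 < ((Real.Gamma (p.ρ / p.κ))⁻¹ * a ^ (k + 1)) ^ 2 * (moment (p.ρ / p.κ) k (a * (x - p.μ)) *
      moment (p.ρ / p.κ) (k + 2) (a * (x - p.μ)) - moment (p.ρ / p.κ) (k + 1) (a * (x - p.μ)) ^ 2) :=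
    mul_pos (by positivity) (by linarith)
  refine this.trans_eq ?_
  ring

/-- The `3 × 3` Hankel determinant of `ψ^{(k)}, …, ψ^{(k+4)}`. -/
noncomputable def hankel (p : Params) (k : ℕ) (x : ℝ) : ℝ :=
  psiD p (k + 4) x * Q p k x - psiD p (k + 3) x * Qderiv p k x + psiD p (k + 2) x * Q p (k + 1) x

lemma hankel_pos (hp : p.Admissible) (k : ℕ) (x : ℝ) : 0 < hankel p k x := by
  have hν : 0 < p.ρ / p.κ := div_pos hp.ρ_pos hp.κ_pos
  have h1 := moment_hankel_pos hν k (√(2 * p.κ) / p.σ * (x - p.μ))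
  have h2 := Real.Gamma_pos_of_pos hν
  have h3 := hp.κ_pos
  have h4 := hp.σ_pos
  have ha : 0 < √(2 * p.κ) / p.σ := by positivity
  simp only [hankel, Q, Qderiv, psiD_eq_moment hp]
  set a := √(2 * p.κ) / p.σ
  refine (mul_pos (a := ((Real.Gamma (p.ρ / p.κ))⁻¹ * a ^ (k + 2)) ^ 3) (by positivity)
    h1).trans_eq ?_
  ring

lemma continuous_psiD (hp : p.Admissible) (k : ℕ) : Continuous (psiD p k) :=
  continuous_iff_continuousAt.2 fun x => (hasDerivAt_psiD hp k x).continuousAt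

/-- `ψ^{(k)}` solves `σ²/2 u'' + κ (μ - x) u' - (ρ + k κ) u = 0`. -/
lemma psiD_ode (hp : p.Admissible) (k : ℕ) (x : ℝ) :
    p.σ ^ 2 / 2 * psiD p (k + 2) x =
      p.κ * (x - p.μ) * psiD p (k + 1) x + (p.ρ + k * p.κ) * psiD p k x := by
  induction k generalizing x with
  | zero =>
    have hν : 0 < p.ρ / p.κ := div_pos hp.ρ_pos hp.κ_pos
    have h3 := hp.κ_pos
    have h4 := hp.σ_pos
    have hsq : √(2 * p.κ) ^ 2 = 2 * p.κ := Real.sq_sqrt (by positivity)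
    simp only [psiD_eq_moment hp]
    simp only [zero_add, Nat.cast_zero, zero_mul, add_zero, pow_zero, pow_one, one_mul, div_pow, hsq]
    rw [moment_two hν]
    field_simp
  | succ k ih =>
    have h1 : HasDerivAt (fun x => p.σ ^ 2 / 2 * psiD p (k + 2) x)
        (p.σ ^ 2 / 2 * psiD p (k + 3) x) x := (hasDerivAt_psiD hp (k + 2) x).const_mul _
    have h0 : HasDerivAt (fun x => p.κ * (x - p.μ)) p.κ x := by
      simpa using ((hasDerivAt_id x).sub_const p.μ).const_mul p.κ
    have h2 := (h0.mul (hasDerivAt_psiD hp (k + 1) x)).add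
      ((hasDerivAt_psiD hp k x).const_mul (p.ρ + k * p.κ))
    have h3 := h1.unique (h2.congr_of_eventuallyEq (Eventually.of_forall fun y => by
      simp only [Pi.add_apply, Pi.mul_apply]; exact ih y))
    push_cast
    linarith

end Psi

/-! ### Turán-type relations between the derivatives of the fundamental solution -/

section Turan

variable {p : Params}

lemma hasDerivAt_Q (hp : p.Admissible) (k : ℕ) (x : ℝ) :
    HasDerivAt (Q p k) (Qderiv p k x) x := by
  have h := ((hasDerivAt_psiD hp k x).mul (hasDerivAt_psiD hp (k + 2) x)).sub
    ((hasDerivAt_psiD hp (k + 1) x).pow 2)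
  refine h.congr_deriv ?_
  simp only [Qderiv]
  ring

lemma hasDerivAt_Qderiv_zero (hp : p.Admissible) (x : ℝ) :
    HasDerivAt (Qderiv p 0) (psiD p 0 x * psiD p 4 x - psiD p 2 x ^ 2) x := by
  have h := ((hasDerivAt_psiD hp 0 x).mul (hasDerivAt_psiD hp 3 x)).sub
    ((hasDerivAt_psiD hp 1 x).mul (hasDerivAt_psiD hp 2 x))
  refine h.congr_deriv ?_
  ring

/-- Links `Q_0'` to `Q_0` and `Q_1`; it evaluates `D` wherever the defect is known. -/
lemma psiD_mul_Qderiv (p : Params) (x : ℝ) :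
    psiD p 1 x * Qderiv p 0 x = psiD p 2 x * Q p 0 x + psiD p 0 x * Q p 1 x := by
  simp only [Q, Qderiv]; ring

/-- Eliminates the coefficient `κ(x - μ)` between the equations of `ψ^{(k)}` and `ψ^{(k+1)}`. -/
lemma Q_succ_eq (hp : p.Admissible) (k : ℕ) (x : ℝ) :
    p.σ ^ 2 / 2 * Q p (k + 1) x =
      p.κ * psiD p (k + 1) x ^ 2 - (p.ρ + k * p.κ) * Q p k x := by
  have h0 := psiD_ode hp k x
  have h1 := psiD_ode hp (k + 1) x
  push_cast at h1
  simp only [Q]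
  linear_combination psiD p (k + 1) x * h1 - psiD p (k + 2) x * h0

/-- `κ (2 (ρ+κ) ψ' Q₁ - ρ ψ'' Q₀') = (σ²/2)² Δ₁`, with `Δ₁` a Hankel determinant. -/
lemma turan_eq_hankel (hp : p.Admissible) (x : ℝ) :
    p.κ * (2 * (p.ρ + p.κ) * psiD p 1 x * Q p 1 x - p.ρ * psiD p 2 x * Qderiv p 0 x) =
      (p.σ ^ 2 / 2) ^ 2 * hankel p 1 x := by
  have h0 := psiD_ode hp 0 x
  have h1 := psiD_ode hp 1 x
  have h2 := psiD_ode hp 2 x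
  have h3 := psiD_ode hp 3 x
  have hq := Q_succ_eq hp 1 x
  push_cast at h0 h1 h2 h3 hq
  have hQ1 : p.σ ^ 2 / 2 * Qderiv p 1 x =
      2 * p.κ * psiD p 1 x * psiD p 2 x - p.ρ * Qderiv p 0 x := by
    simp only [Qderiv]
    linear_combination psiD p 1 x * h2 - psiD p 3 x * h0
  have hΔ : p.σ ^ 2 / 2 * hankel p 1 x =
      p.κ * (2 * psiD p 3 x * Q p 1 x - psiD p 2 x * Qderiv p 1 x) := by
    simp only [hankel, Q, Qderiv]
    -- Substituting the equations of orders 1, 2, 3 for the top derivatives makes the terms in `x -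
    -- μ` and `ρ` cancel, because a determinant with a repeated row vanishes; only the increments of
    -- `κ` survive.
    norm_num
    linear_combination (psiD p 1 x * psiD p 3 x - psiD p 2 x ^ 2) * h3
      - (psiD p 1 x * psiD p 4 x - psiD p 2 x * psiD p 3 x) * h2
      + (psiD p 2 x * psiD p 4 x - psiD p 3 x ^ 2) * h1
  have hq2 : psiD p 2 x * Qderiv p 1 x = psiD p 3 x * Q p 1 x + psiD p 1 x * Q p 2 x := by
    simp only [Q, Qderiv]; ring
  norm_num at hq
  linear_combination -(p.σ ^ 2 / 2) * hΔ - p.κ * psiD p 2 x * hQ1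
    + 2 * p.κ * psiD p 1 x * hq + p.κ * p.σ ^ 2 * hq2

lemma turan_pos (hp : p.Admissible) (x : ℝ) :
    0 < 2 * (p.ρ + p.κ) * psiD p 1 x * Q p 1 x - p.ρ * psiD p 2 x * Qderiv p 0 x := by
  have h := turan_eq_hankel hp x
  have h1 : 0 < (p.σ ^ 2 / 2) ^ 2 * hankel p 1 x := by
    have := hp.σ_pos
    have := hankel_pos hp 1 x
    positivity
  rw [← h] at h1
  exact pos_of_mul_pos_right h1 hp.κ_pos.le

/-- The ratio `Q₀' / Q₁`. -/
noncomputable def ratioQ (p : Params) (z : ℝ) : ℝ := Qderiv p 0 z / Q p 1 z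

/-- The numerator of the quotient rule factors through the order 3 Hankel determinant, so `Q_0'/Q_1`
is strictly decreasing. This supports the barrier that keeps the solution away from `D = 0`. -/
lemma hasDerivAt_ratioQ (hp : p.Admissible) (z : ℝ) :
    HasDerivAt (ratioQ p) (-(psiD p 2 z * hankel p 0 z / Q p 1 z ^ 2)) z := by
  refine ((hasDerivAt_Qderiv_zero hp z).div (hasDerivAt_Q hp 1 z) (Q_pos hp 1 z).ne').congr_deriv ?_
  rw [neg_div', div_left_inj' (pow_ne_zero 2 (Q_pos hp 1 z).ne')]
  simp only [hankel, Q, Qderiv]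
  ring

lemma continuous_Q (hp : p.Admissible) (k : ℕ) : Continuous (Q p k) :=
  continuous_iff_continuousAt.2 fun x => (hasDerivAt_Q hp k x).continuousAt

/-- The derivative of the quotient is `-Q_k / (ψ^{(k+1)})²`. -/
lemma antitone_psiD_div (hp : p.Admissible) (k : ℕ) :
    StrictAnti fun z => psiD p k z / psiD p (k + 1) z := by
  refine strictAnti_of_hasDerivAt_neg (f' := fun z => -(Q p k z / psiD p (k + 1) z ^ 2))
    (fun z => ?_) fun z => ?_
  · refine ((hasDerivAt_psiD hp k z).div (hasDerivAt_psiD hp (k + 1) z)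
      (psiD_pos hp _ z).ne').congr_deriv ?_
    simp only [Q]
    ring
  · have := Q_pos hp k z
    have := psiD_pos hp (k + 1) z
    simp only [Left.neg_neg_iff]
    positivity

end Turan

/-! ### The vector field of the free boundary -/

section Field

variable {p : Params}

/-- `(ρ + κ) (c - R_y)` at the shifted point `(z, y)`. -/
noncomputable def gap (p : Params) (y z : ℝ) : ℝ := (p.ρ + p.κ) * (p.c - Rtilde p z y)

/-- `(ρ+κ)(c - R_y) ψ' + ψ`, which has the sign of `-A`. -/
noncomputable def defect (p : Params) (y z : ℝ) : ℝ := gap p y z * psiD p 1 z + psiD p 0 z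

lemma gap_eq (hp : p.Admissible) (y z : ℝ) :
    gap p y z = (p.ρ + p.κ) * p.c - p.μ * p.κ / p.ρ - z + p.β * (p.ρ + 2 * p.κ) / p.ρ * y := by
  have := hp.ρ_pos
  have := hp.κ_pos
  have h : p.ρ + p.κ ≠ 0 := by positivity
  rw [gap, Rtilde]
  field_simp
  ring

lemma hasDerivAt_gap (hp : p.Admissible) (y z : ℝ) : HasDerivAt (gap p y) (-1) z := by
  have : gap p y = fun z => (p.ρ + p.κ) * p.c - p.μ * p.κ / p.ρ - z
      + p.β * (p.ρ + 2 * p.κ) / p.ρ * y := funext fun z => gap_eq hp y z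
  rw [this]
  simpa using ((hasDerivAt_id z).const_sub
    ((p.ρ + p.κ) * p.c - p.μ * p.κ / p.ρ)).add_const (p.β * (p.ρ + 2 * p.κ) / p.ρ * y)

lemma ODEden_eq (p : Params) (y z : ℝ) :
    ODEden p y z = psiD p 0 z * (gap p y z * Q p 1 z + Qderiv p 0 z) := by
  rw [ODEden, psiD_zero, gap]

lemma ODEden_eq_mul (hp : p.Admissible) (y z : ℝ) :
    ODEden p y z = psiD p 0 z * Q p 1 z * (gap p y z + ratioQ p z) := by
  have := (Q_pos hp 1 z).ne'
  rw [ODEden_eq, ratioQ]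
  field_simp

lemma ODEnum_eq (hp : p.Admissible) (y z : ℝ) :
    ODEnum p y z = Q p 0 z *
      (2 * (p.ρ + p.κ) / p.ρ * psiD p 1 z + gap p y z * psiD p 2 z) := by
  have := hp.ρ_pos.ne'
  rw [ODEnum, gap]
  field_simp
  ring

lemma H_eq_defect (hp : p.Admissible) (z : ℝ) :
    (p.ρ + p.κ) * H p z = defect p p.ymax z := by
  have : p.ρ + p.κ ≠ 0 := (add_pos hp.ρ_pos hp.κ_pos).ne'
  rw [H, defect, gap, psiD_zero]
  field_simp

lemma coeffA_eq (hp : p.Admissible) (Ft : ℝ → ℝ) (y : ℝ) :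
    coeffA p Ft y = -(defect p y (Ft y) / (p.β * (p.ρ + p.κ) * Q p 0 (Ft y))) := by
  have : p.ρ + p.κ ≠ 0 := (add_pos hp.ρ_pos hp.κ_pos).ne'
  have := hp.β_pos.ne'
  have := (Q_pos hp 0 (Ft y)).ne'
  rw [coeffA, defect, gap, psiD_zero]
  field_simp

/-- In general `ψ' D = ψ (Q_1 v + ψ'' Q_0)`, where `v` is the defect. -/
lemma ODEden_pos_of_defect_eq_zero (hp : p.Admissible) {y z : ℝ} (h : defect p y z = 0) :
    0 < ODEden p y z := by
  have h0 := psiD_pos hp 0 z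
  have h1 := psiD_pos hp 1 z
  have h2 := psiD_pos hp 2 z
  have hQ := Q_pos hp 0 z
  have hid := psiD_mul_Qderiv p z
  have : 0 < psiD p 1 z * ODEden p y z := by
    have heq : psiD p 1 z * ODEden p y z = psiD p 0 z * (psiD p 2 z * Q p 0 z) := by
      rw [defect] at h
      rw [ODEden_eq]
      linear_combination psiD p 0 z * Q p 1 z * h + psiD p 0 z * hid
    rw [heq]; positivity
  exact pos_of_mul_pos_right this h1.le

/-- On `v = 0`, `Q_succ_eq` collapses `ρψ'(N - D)` to `σ² Q_0 Q_1`. -/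
lemma ODEden_lt_ODEnum_of_defect_eq_zero (hp : p.Admissible) {y z : ℝ} (h : defect p y z = 0) :
    ODEden p y z < ODEnum p y z := by
  have h1 := psiD_pos hp 1 z
  have hρ := hp.ρ_pos
  have hQ0 := Q_pos hp 0 z
  have hQ1 := Q_pos hp 1 z
  have hσ := hp.σ_pos
  have hid := psiD_mul_Qderiv p z
  have hsucc := Q_succ_eq hp 0 z
  norm_num at hsucc
  have hpos : 0 < p.ρ * psiD p 1 z * (ODEnum p y z - ODEden p y z) := by
    have heq : p.ρ * psiD p 1 z * (ODEnum p y z - ODEden p y z) =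
        2 * Q p 0 z * (p.σ ^ 2 / 2 * Q p 1 z) := by
      have hQe : psiD p 0 z * psiD p 2 z = Q p 0 z + psiD p 1 z ^ 2 := by
        simp only [Q]; ring
      rw [defect] at h
      rw [ODEnum_eq hp, ODEden_eq]
      field_simp
      linear_combination p.ρ * (psiD p 2 z * Q p 0 z - psiD p 0 z * Q p 1 z) * h
        - p.ρ * psiD p 0 z * hid - 2 * p.ρ * Q p 0 z * hQe - 2 * Q p 0 z * hsucc
    rw [heq]; positivity
  have := pos_of_mul_pos_right hpos (by positivity)
  linarith

/-- On `{A ≥ 0, D > 0}` the boundary moves faster than `β`. -/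
lemma ODEden_lt_ODEnum (hp : p.Admissible) {y z : ℝ} (h : defect p y z ≤ 0)
    (hD : 0 < ODEden p y z) : ODEden p y z < ODEnum p y z := by
  have h0 := psiD_pos hp 0 z
  have h1 := psiD_pos hp 1 z
  have hρ := hp.ρ_pos
  have hβ := hp.β_pos
  have hκ := hp.κ_pos
  have hQ0 := Q_pos hp 0 z
  have hQ1 := Q_pos hp 1 z
  -- the power level at which the defect vanishes
  have hslope : 0 < p.β * (p.ρ + 2 * p.κ) / p.ρ := by positivity
  obtain ⟨y', hy'⟩ : ∃ y', gap p y' z = -(psiD p 0 z / psiD p 1 z) := by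
    refine ⟨y + (-(psiD p 0 z / psiD p 1 z) - gap p y z) / (p.β * (p.ρ + 2 * p.κ) / p.ρ), ?_⟩
    rw [gap_eq hp, gap_eq hp, mul_add, mul_div_cancel₀ _ hslope.ne']
    ring
  have hv : defect p y' z = 0 := by rw [defect, hy']; field_simp; ring
  have hle : gap p y z ≤ gap p y' z := by
    rw [hy', ← neg_div, le_div_iff₀ h1]
    rw [defect] at h; linarith
  have hend := ODEden_lt_ODEnum_of_defect_eq_zero hp hv
  have hT := turan_pos hp z
  rw [ODEnum_eq hp, ODEden_eq] at *
  have hD' : 0 < gap p y z * Q p 1 z + Qderiv p 0 z := pos_of_mul_pos_right hD h0.le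
  set t := gap p y z
  set t' := gap p y' z
  -- With `z` fixed, `N - D` is affine in the gap, with this slope. If the slope is `≤ 0`, lowering
  -- the gap from `t'` (where `v = 0`) to `t` cannot decrease `N - D`. If it is `≥ 0`, comparison is
  -- made with the zero of `D` instead, where the Turán expression governs the sign of `N`.
  rcases le_total (Q p 0 z * psiD p 2 z - psiD p 0 z * Q p 1 z) 0 with hs | hs
  · nlinarith [mul_nonneg (sub_nonneg.2 hle) (neg_nonneg.2 hs)]
  · have hk : 0 < p.ρ * Q p 1 z * (Q p 0 z * (2 * (p.ρ + p.κ) / p.ρ * psiD p 1 z + t * psiD p 2 z)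
        - psiD p 0 z * (t * Q p 1 z + Qderiv p 0 z)) := by
      have : p.ρ * Q p 1 z * (Q p 0 z * (2 * (p.ρ + p.κ) / p.ρ * psiD p 1 z + t * psiD p 2 z)
          - psiD p 0 z * (t * Q p 1 z + Qderiv p 0 z)) =
          Q p 0 z * (2 * (p.ρ + p.κ) * psiD p 1 z * Q p 1 z - p.ρ * psiD p 2 z * Qderiv p 0 z)
          + p.ρ * ((Q p 0 z * psiD p 2 z - psiD p 0 z * Q p 1 z)
            * (t * Q p 1 z + Qderiv p 0 z)) := by
        field_simp
        ring
      rw [this]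
      have := mul_pos hQ0 hT
      have := mul_nonneg hρ.le (mul_nonneg hs hD'.le)
      linarith
    have := pos_of_mul_pos_right hk (by positivity)
    linarith

/-- Coefficients of the vector field as a function of `χ = D / (ψ Q₁)`. -/
noncomputable def fieldConst (p : Params) (z : ℝ) : ℝ :=
  Q p 0 z * psiD p 2 z / (psiD p 0 z * Q p 1 z)

/-- See `fieldConst`. -/
noncomputable def fieldPole (p : Params) (z : ℝ) : ℝ :=
  Q p 0 z * (2 * (p.ρ + p.κ) * psiD p 1 z * Q p 1 z - p.ρ * psiD p 2 z * Qderiv p 0 z) /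
    (p.ρ * psiD p 0 z * Q p 1 z ^ 2)

lemma fieldConst_pos (hp : p.Admissible) (z : ℝ) : 0 < fieldConst p z :=
  div_pos (mul_pos (Q_pos hp 0 z) (psiD_pos hp 2 z)) (mul_pos (psiD_pos hp 0 z) (Q_pos hp 1 z))

lemma fieldPole_pos (hp : p.Admissible) (z : ℝ) : 0 < fieldPole p z :=
  div_pos (mul_pos (Q_pos hp 0 z) (turan_pos hp z))
    (mul_pos (mul_pos hp.ρ_pos (psiD_pos hp 0 z)) (pow_pos (Q_pos hp 1 z) 2))

lemma ODEnum_div_ODEden (hp : p.Admissible) {y z : ℝ} (h : gap p y z + ratioQ p z ≠ 0) :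
    ODEnum p y z / ODEden p y z =
      fieldConst p z + fieldPole p z / (gap p y z + ratioQ p z) := by
  have h0 := (psiD_pos hp 0 z).ne'
  have hQ1 := (Q_pos hp 1 z).ne'
  have hρ := hp.ρ_pos.ne'
  have hnum : ODEnum p y z = psiD p 0 z * Q p 1 z *
      (fieldConst p z * (gap p y z + ratioQ p z) + fieldPole p z) := by
    rw [ODEnum_eq hp, fieldConst, fieldPole, ratioQ]
    field_simp
    ring
  rw [hnum, ODEden_eq_mul hp, mul_div_mul_left _ _ (mul_ne_zero h0 hQ1), add_div,
    mul_div_cancel_right₀ _ h]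

end Field

/-! ### Solutions of the free-boundary equation -/

section Barrier

lemma hasDerivWithinAt_Ici_of_Icc {f : ℝ → ℝ} {f' a b x : ℝ} (hx : x ∈ Ico a b)
    (h : HasDerivWithinAt f f' (Icc a b) x) : HasDerivWithinAt f f' (Ici x) x :=
  h.mono_of_mem_nhdsWithin (mem_of_superset (Icc_mem_nhdsGE hx.2) (Icc_subset_Icc_left hx.1))

/-- A function that is `≤ 0` at the right end point and increases through each of its zeros
is `≤ 0`. -/
lemma nonpos_of_deriv_pos_at_zeros {f f' : ℝ → ℝ} {a b : ℝ}
    (hf : ∀ y ∈ Icc a b, HasDerivWithinAt f (f' y) (Icc a b) y) (hb : f b ≤ 0)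
    (h : ∀ y ∈ Icc a b, f y = 0 → 0 < f' y) : ∀ y ∈ Icc a b, f y ≤ 0 := by
  intro y hy
  -- Time is reversed so that the right end point becomes the initial time of the comparison
  -- theorem.
  have hmem : ∀ t, t ∈ Icc (-b) (-a) → -t ∈ Icc a b := fun t ht =>
    ⟨by linarith [ht.2], by linarith [ht.1]⟩
  have hd : ∀ t ∈ Icc (-b) (-a), HasDerivWithinAt (fun t => f (-t)) (-f' (-t))
      (Icc (-b) (-a)) t := fun t ht => by
    have := (hf (-t) (hmem t ht)).scomp t (hasDerivWithinAt_neg t (Icc (-b) (-a))) hmem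
    exact this.congr_deriv (by simp)
  have key := image_le_of_deriv_right_lt_deriv_boundary' (f := fun t => f (-t))
    (f' := fun t => -f' (-t)) (a := -b) (b := -a) (B := fun _ => 0) (B' := fun _ => 0)
    (fun t ht => (hd t ht).continuousWithinAt)
    (fun t ht => hasDerivWithinAt_Ici_of_Icc ht (hd t (Ico_subset_Icc_self ht)))
    (by simpa using hb) continuousOn_const (fun t _ => hasDerivWithinAt_const _ _ _)
    (fun t ht h0 => by
      have := h (-t) (hmem t (Ico_subset_Icc_self ht)) h0
      simpa using this)
  have := key (x := -y) ⟨by linarith [hy.2], by linarith [hy.1]⟩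
  simpa using this

lemma strictMonoOn_of_hasDerivWithinAt_Icc {f f' : ℝ → ℝ} {a b : ℝ}
    (hf : ∀ y ∈ Icc a b, HasDerivWithinAt f (f' y) (Icc a b) y)
    (h : ∀ y ∈ Icc a b, 0 < f' y) : StrictMonoOn f (Icc a b) := by
  refine strictMonoOn_of_deriv_pos (convex_Icc a b) (fun y hy => (hf y hy).continuousWithinAt) ?_
  rw [interior_Icc]
  intro y hy
  rw [((hf y (Ioo_subset_Icc_self hy)).hasDerivAt (Icc_mem_nhds hy.1 hy.2)).deriv]
  exact h y (Ioo_subset_Icc_self hy)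

end Barrier

/-! ### Gap, defect and the coefficient `A` along a solution curve -/

section Curve

variable {p : Params}

/-- The derivative in `y` of `gap p y z`. -/
noncomputable def gapSlope (p : Params) : ℝ := p.β * (p.ρ + 2 * p.κ) / p.ρ

lemma gapSlope_pos (hp : p.Admissible) : 0 < gapSlope p := by
  have := hp.β_pos
  have := hp.ρ_pos
  have := hp.κ_pos
  unfold gapSlope
  positivity

lemma hasDerivWithinAt_gap_comp (hp : p.Admissible) {z : ℝ → ℝ} {q y : ℝ} {S : Set ℝ}
    (hz : HasDerivWithinAt z q S y) :
    HasDerivWithinAt (fun y => gap p y (z y)) (gapSlope p - q) S y := by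
  have : (fun y => gap p y (z y)) = fun y => (p.ρ + p.κ) * p.c - p.μ * p.κ / p.ρ - z y
      + p.β * (p.ρ + 2 * p.κ) / p.ρ * y := funext fun y => gap_eq hp y (z y)
  rw [this]
  refine ((hz.const_sub _).add ((hasDerivWithinAt_id y S).const_mul _)).congr_deriv ?_
  rw [gapSlope]; ring

lemma hasDerivWithinAt_defect_comp (hp : p.Admissible) {z : ℝ → ℝ} {q y : ℝ} {S : Set ℝ}
    (hz : HasDerivWithinAt z q S y) :
    HasDerivWithinAt (fun y => defect p y (z y))
      (gapSlope p * psiD p 1 (z y) + gap p y (z y) * psiD p 2 (z y) * q) S y := by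
  have h1 := (hasDerivAt_psiD hp 1 (z y)).comp_hasDerivWithinAt y hz
  have h0 := (hasDerivAt_psiD hp 0 (z y)).comp_hasDerivWithinAt y hz
  refine (((hasDerivWithinAt_gap_comp hp hz).mul h1).add h0).congr_deriv ?_
  simp only [Function.comp_apply]
  ring

/-- The equation of the curve is used here to remove `q` from every term except the one carrying
`v`. That term is what the quotient rule for `v / Q_0` cancels, and it disappears on `v = 0`. The
equation is taken in the form `qD = βN` so that the regularized field can use it too. -/
lemma Q_mul_deriv_defect (hp : p.Admissible) {y z q : ℝ}
    (hq : q * ODEden p y z = p.β * ODEnum p y z) :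
    Q p 0 z * (gapSlope p * psiD p 1 z + gap p y z * psiD p 2 z * q) =
      -(p.β * Q p 0 z * (gap p y z * psiD p 2 z + psiD p 1 z)) +
        defect p y z * Qderiv p 0 z * q := by
  have hρ := hp.ρ_pos.ne'
  have hid := psiD_mul_Qderiv p z
  rw [ODEden_eq, ODEnum_eq hp] at hq
  have hs : gapSlope p = p.β * (2 * (p.ρ + p.κ) / p.ρ) - p.β := by
    rw [gapSlope]; field_simp; ring
  rw [hs, defect]
  linear_combination (-q * gap p y z) * hid - hq

/-- The derivative of the coefficient `A` along the free boundary. -/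
noncomputable def slopeA (p : Params) (y z : ℝ) : ℝ :=
  (gap p y z * psiD p 2 z + psiD p 1 z) / ((p.ρ + p.κ) * Q p 0 z)

lemma slopeA_neg (hp : p.Admissible) {y z : ℝ} (h : defect p y z ≤ 0) : slopeA p y z < 0 := by
  have h1 := psiD_pos hp 1 z
  have h2 := psiD_pos hp 2 z
  have hQ := Q_pos hp 0 z
  refine div_neg_of_neg_of_pos ?_ (mul_pos (add_pos hp.ρ_pos hp.κ_pos) hQ)
  -- Inserting `gψ' ≤ -ψ` leaves `-ψψ'' + ψ'² = -Q_0`.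
  have h3 : psiD p 1 z * (gap p y z * psiD p 2 z + psiD p 1 z) ≤ -Q p 0 z := by
    rw [defect] at h
    simp only [Q]
    nlinarith [mul_le_mul_of_nonneg_left h h2.le]
  by_contra hcon
  push Not at hcon
  have := mul_nonneg h1.le hcon
  linarith

lemma hasDerivWithinAt_coeffA (hp : p.Admissible) {Ft : ℝ → ℝ} {y : ℝ} {S : Set ℝ}
    (hD : ODEden p y (Ft y) ≠ 0)
    (hF : HasDerivWithinAt Ft (p.β * (ODEnum p y (Ft y) / ODEden p y (Ft y))) S y) :
    HasDerivWithinAt (coeffA p Ft) (slopeA p y (Ft y)) S y := by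
  have hQ := (Q_pos hp 0 (Ft y)).ne'
  have hβ := hp.β_pos.ne'
  have hρκ : p.ρ + p.κ ≠ 0 := (add_pos hp.ρ_pos hp.κ_pos).ne'
  have hA : coeffA p Ft = fun y => -(defect p y (Ft y) / (p.β * (p.ρ + p.κ) * Q p 0 (Ft y))) :=
    funext fun y => coeffA_eq hp Ft y
  rw [hA]
  have hq : p.β * (ODEnum p y (Ft y) / ODEden p y (Ft y)) * ODEden p y (Ft y) =
      p.β * ODEnum p y (Ft y) := by field_simp
  have key := Q_mul_deriv_defect hp hq
  have h1 := ((hasDerivAt_Q hp 0 (Ft y)).comp_hasDerivWithinAt y hF).const_mul (p.β * (p.ρ + p.κ))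
  refine (((hasDerivWithinAt_defect_comp hp hF).div h1 (by simp [hQ, hβ, hρκ])).neg).congr_deriv ?_
  simp only [Function.comp_apply]
  rw [slopeA, neg_eq_iff_eq_neg, div_eq_iff (by positivity)]
  generalize p.β * (ODEnum p y (Ft y) / ODEden p y (Ft y)) = q at *
  field_simp
  linear_combination key

/-- Together with `slopeA_system_deriv`, this is the smooth-fit system: `w_y = c` here and `w_xy =
0` there. -/
lemma slopeA_system_value (hp : p.Admissible) (Ft : ℝ → ℝ) (y : ℝ) :
    slopeA p y (Ft y) * psiD p 0 (Ft y) + p.β * coeffA p Ft y * psiD p 1 (Ft y) =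
      gap p y (Ft y) / (p.ρ + p.κ) := by
  have hQ := (Q_pos hp 0 (Ft y)).ne'
  have hβ := hp.β_pos.ne'
  have hρκ : p.ρ + p.κ ≠ 0 := (add_pos hp.ρ_pos hp.κ_pos).ne'
  rw [coeffA_eq hp, slopeA, defect]
  field_simp
  simp only [Q]
  ring

lemma slopeA_system_deriv (hp : p.Admissible) (Ft : ℝ → ℝ) (y : ℝ) :
    slopeA p y (Ft y) * psiD p 1 (Ft y) + p.β * coeffA p Ft y * psiD p 2 (Ft y) =
      -(1 / (p.ρ + p.κ)) := by
  have hQ := (Q_pos hp 0 (Ft y)).ne'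
  have hβ := hp.β_pos.ne'
  have hρκ : p.ρ + p.κ ≠ 0 := (add_pos hp.ρ_pos hp.κ_pos).ne'
  rw [coeffA_eq hp, slopeA, defect]
  field_simp
  simp only [Q]
  ring

/-- The left side is `w_yxx` on the boundary, from the waiting side; it equals `-D / ((ρ+κ) ψ Q_0)`.
-/
lemma slopeA_system_concave (hp : p.Admissible) (Ft : ℝ → ℝ) {y : ℝ}
    (hD : 0 < ODEden p y (Ft y)) :
    slopeA p y (Ft y) * psiD p 2 (Ft y) + p.β * coeffA p Ft y * psiD p 3 (Ft y) < 0 := by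
  have h0 := psiD_pos hp 0 (Ft y)
  have hQ := Q_pos hp 0 (Ft y)
  have hβ := hp.β_pos.ne'
  have hρκ : 0 < p.ρ + p.κ := add_pos hp.ρ_pos hp.κ_pos
  have hρκ' := hρκ.ne'
  rw [ODEden_eq] at hD
  have hD' := pos_of_mul_pos_right hD h0.le
  have : slopeA p y (Ft y) * psiD p 2 (Ft y) + p.β * coeffA p Ft y * psiD p 3 (Ft y) =
      -((gap p y (Ft y) * Q p 1 (Ft y) + Qderiv p 0 (Ft y)) / ((p.ρ + p.κ) * Q p 0 (Ft y))) := by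
    rw [coeffA_eq hp, slopeA, defect]
    field_simp
    simp only [Q, Qderiv]
    ring
  rw [this, neg_lt_zero]
  positivity

end Curve

/-! ### Properties of every shifted boundary -/

namespace IsShiftedBoundary

variable {p : Params} {Ft : ℝ → ℝ}

lemma defect_terminal (hF : IsShiftedBoundary p Ft) (hp : p.Admissible) :
    defect p p.ymax (Ft p.ymax) = 0 := by
  rw [← H_eq_defect hp, hF.terminal, mul_zero]

lemma continuousOn (hF : IsShiftedBoundary p Ft) : ContinuousOn Ft (Icc 0 p.ymax) :=
  fun y hy => (hF.ode y hy).continuousWithinAt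

lemma continuousOn_gap (hF : IsShiftedBoundary p Ft) (hp : p.Admissible) :
    ContinuousOn (fun y => gap p y (Ft y)) (Icc 0 p.ymax) :=
  fun y hy => (hasDerivWithinAt_gap_comp hp (hF.ode y hy)).continuousWithinAt

lemma continuousOn_comp (hF : IsShiftedBoundary p Ft) {f : ℝ → ℝ} (hf : Continuous f) :
    ContinuousOn (fun y => f (Ft y)) (Icc 0 p.ymax) :=
  hf.comp_continuousOn hF.continuousOn

lemma continuous_Qderiv_zero (hp : p.Admissible) : Continuous (Qderiv p 0) :=
  continuous_iff_continuousAt.2 fun x => (hasDerivAt_Qderiv_zero hp x).continuousAt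

lemma continuousOn_ODEden (hF : IsShiftedBoundary p Ft) (hp : p.Admissible) :
    ContinuousOn (fun y => ODEden p y (Ft y)) (Icc 0 p.ymax) := by
  simp_rw [ODEden_eq]
  exact (hF.continuousOn_comp (continuous_psiD hp 0)).mul
    (((hF.continuousOn_gap hp).mul (hF.continuousOn_comp (continuous_Q hp 1))).add
      (hF.continuousOn_comp (continuous_Qderiv_zero hp)))

lemma continuousOn_ODEnum (hF : IsShiftedBoundary p Ft) (hp : p.Admissible) :
    ContinuousOn (fun y => ODEnum p y (Ft y)) (Icc 0 p.ymax) := by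
  simp_rw [ODEnum_eq hp]
  exact (hF.continuousOn_comp (continuous_Q hp 0)).mul
    ((continuousOn_const.mul (hF.continuousOn_comp (continuous_psiD hp 1))).add
      ((hF.continuousOn_gap hp).mul (hF.continuousOn_comp (continuous_psiD hp 2))))

/-- `D` is positive at the terminal point, where the defect vanishes, and it has no zero on the
curve. -/
lemma ODEden_pos (hF : IsShiftedBoundary p Ft) (hp : p.Admissible) :
    ∀ y ∈ Icc 0 p.ymax, 0 < ODEden p y (Ft y) := by
  intro y hy
  by_contra hcon
  push Not at hcon
  have hterm := ODEden_pos_of_defect_eq_zero hp (hF.defect_terminal hp)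
  have hsub : Icc y p.ymax ⊆ Icc 0 p.ymax := Icc_subset_Icc_left hy.1
  obtain ⟨t, ht, h0⟩ := intermediate_value_Icc hy.2 ((hF.continuousOn_ODEden hp).mono hsub)
    (⟨hcon, hterm.le⟩ : (0 : ℝ) ∈ Icc _ _)
  exact hF.den_ne_zero t (hsub ht) h0

lemma hasDerivWithinAt_coeffA (hF : IsShiftedBoundary p Ft) (hp : p.Admissible) :
    ∀ y ∈ Icc 0 p.ymax, HasDerivWithinAt (coeffA p Ft) (slopeA p y (Ft y)) (Icc 0 p.ymax) y :=
  fun y hy => SolarInstallation.hasDerivWithinAt_coeffA hp (hF.den_ne_zero y hy) (hF.ode y hy)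

lemma coeffA_terminal (hF : IsShiftedBoundary p Ft) (hp : p.Admissible) :
    coeffA p Ft p.ymax = 0 := by
  rw [coeffA_eq hp, hF.defect_terminal hp]; simp

lemma defect_nonpos_iff (hp : p.Admissible) (y : ℝ) :
    defect p y (Ft y) ≤ 0 ↔ 0 ≤ coeffA p Ft y := by
  have : 0 < p.β * (p.ρ + p.κ) * Q p 0 (Ft y) :=
    mul_pos (mul_pos hp.β_pos (add_pos hp.ρ_pos hp.κ_pos)) (Q_pos hp 0 _)
  rw [coeffA_eq hp, ← neg_div, le_div_iff₀ this]
  constructor <;> intro h <;> linarith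

/-- Barrier argument from the right end, where `A = 0`: at each zero of `A` its derivative is
negative, so `-A` can only cross zero upwards. -/
lemma coeffA_nonneg (hF : IsShiftedBoundary p Ft) (hp : p.Admissible) :
    ∀ y ∈ Icc 0 p.ymax, 0 ≤ coeffA p Ft y := by
  have := nonpos_of_deriv_pos_at_zeros (f := fun y => -coeffA p Ft y)
    (fun y hy => (hF.hasDerivWithinAt_coeffA hp y hy).neg) (by simp [hF.coeffA_terminal hp])
    (fun y _ h0 => by
      have := slopeA_neg hp ((defect_nonpos_iff (Ft := Ft) hp y).2 (by linarith))
      linarith)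
  intro y hy
  have := this y hy
  linarith

lemma ODEden_lt_ODEnum (hF : IsShiftedBoundary p Ft) (hp : p.Admissible) :
    ∀ y ∈ Icc 0 p.ymax, ODEden p y (Ft y) < ODEnum p y (Ft y) := fun y hy =>
  SolarInstallation.ODEden_lt_ODEnum hp
    ((defect_nonpos_iff hp y).2 (hF.coeffA_nonneg hp y hy)) (hF.ODEden_pos hp y hy)

/-- The derivative of the free boundary. -/
noncomputable def speed (p : Params) (Ft : ℝ → ℝ) (y : ℝ) : ℝ :=
  p.β * (ODEnum p y (Ft y) / ODEden p y (Ft y)) - p.β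

lemma hasDerivWithinAt_boundary (hF : IsShiftedBoundary p Ft) :
    ∀ y ∈ Icc 0 p.ymax, HasDerivWithinAt (boundary p Ft) (speed p Ft y) (Icc 0 p.ymax) y := by
  intro y hy
  have := (hF.ode y hy).sub ((hasDerivWithinAt_id y (Icc 0 p.ymax)).const_mul p.β)
  rw [mul_one] at this
  exact this

lemma speed_pos (hF : IsShiftedBoundary p Ft) (hp : p.Admissible) :
    ∀ y ∈ Icc 0 p.ymax, 0 < speed p Ft y := by
  intro y hy
  have h1 : 1 < ODEnum p y (Ft y) / ODEden p y (Ft y) :=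
    (one_lt_div (hF.ODEden_pos hp y hy)).2 (hF.ODEden_lt_ODEnum hp y hy)
  have := mul_lt_mul_of_pos_left h1 hp.β_pos
  rw [speed]; linarith

lemma continuousOn_speed (hF : IsShiftedBoundary p Ft) (hp : p.Admissible) :
    ContinuousOn (speed p Ft) (Icc 0 p.ymax) :=
  (continuousOn_const.mul ((hF.continuousOn_ODEnum hp).div (hF.continuousOn_ODEden hp)
    hF.den_ne_zero)).sub continuousOn_const

lemma strictMonoOn_boundary (hF : IsShiftedBoundary p Ft) (hp : p.Admissible) :
    StrictMonoOn (boundary p Ft) (Icc 0 p.ymax) :=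
  strictMonoOn_of_hasDerivWithinAt_Icc hF.hasDerivWithinAt_boundary (hF.speed_pos hp)

/-- The free boundary expands distances at least by a positive factor. -/
lemma exists_expansion (hF : IsShiftedBoundary p Ft) (hp : p.Admissible) :
    ∃ m > 0, ∀ s ∈ Icc 0 p.ymax, ∀ t ∈ Icc 0 p.ymax, s ≤ t →
      m * (t - s) ≤ boundary p Ft t - boundary p Ft s := by
  obtain ⟨y₀, hy₀, hmin⟩ := isCompact_Icc.exists_isMinOn
    (nonempty_Icc.2 hp.ymax_pos.le) (hF.continuousOn_speed hp)
  refine ⟨speed p Ft y₀, hF.speed_pos hp y₀ hy₀, fun s hs t ht hst => ?_⟩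
  refine (convex_Icc 0 p.ymax).mul_sub_le_image_sub_of_le_deriv
    (fun y hy => (hF.hasDerivWithinAt_boundary y hy).continuousWithinAt)
    (fun y hy => ?_) (fun y hy => ?_) s hs t ht hst
  · rw [interior_Icc] at hy
    rw [interior_Icc]
    exact ((hF.hasDerivWithinAt_boundary y (Ioo_subset_Icc_self hy)).mono
      Ioo_subset_Icc_self).differentiableWithinAt
  · rw [interior_Icc] at hy
    rw [((hF.hasDerivWithinAt_boundary y (Ioo_subset_Icc_self hy)).hasDerivAt
      (Icc_mem_nhds hy.1 hy.2)).deriv]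
    exact hmin (Ioo_subset_Icc_self hy)

end IsShiftedBoundary

/-! ### Existence of a shifted boundary -/

section Existence

variable {p : Params}

lemma exists_lipschitz_Icc {f f' : ℝ → ℝ} (hf : ∀ z, HasDerivAt f (f' z) z) (hf' : Continuous f')
    (a b : ℝ) : ∃ L, 0 ≤ L ∧ ∀ s ∈ Icc a b, ∀ t ∈ Icc a b, |f s - f t| ≤ L * |s - t| := by
  obtain ⟨L, hL⟩ := isCompact_Icc.exists_bound_of_continuousOn (s := Icc a b) hf'.continuousOn
  refine ⟨|L|, abs_nonneg _, fun s hs t ht => ?_⟩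
  exact (convex_Icc a b).norm_image_sub_le_of_norm_hasDerivWithin_le
    (fun z _ => (hf z).hasDerivWithinAt) (fun z hz => (hL z hz).trans (le_abs_self L)) ht hs

lemma exists_hasDerivAt_fieldConst (hp : p.Admissible) :
    ∃ f', (∀ z, HasDerivAt (fieldConst p) (f' z) z) ∧ Continuous f' := by
  have h0 := fun z => (psiD_pos hp 0 z).ne'
  have h1 := fun z => (Q_pos hp 1 z).ne'
  have hc := continuous_psiD hp
  have hc' := continuous_Q hp
  refine ⟨_, fun z => ((hasDerivAt_Q hp 0 z).mul (hasDerivAt_psiD hp 2 z)).div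
    ((hasDerivAt_psiD hp 0 z).mul (hasDerivAt_Q hp 1 z)) (mul_ne_zero (h0 z) (h1 z)), ?_⟩
  have h2 : Continuous (Qderiv p 0) := IsShiftedBoundary.continuous_Qderiv_zero hp
  have h3 : Continuous (Qderiv p 1) := by unfold Qderiv; fun_prop
  refine Continuous.div (by simp only [Pi.mul_apply]; fun_prop) (by fun_prop) fun z => ?_
  exact pow_ne_zero 2 (mul_ne_zero (h0 z) (h1 z))

lemma exists_hasDerivAt_fieldPole (hp : p.Admissible) :
    ∃ f', (∀ z, HasDerivAt (fieldPole p) (f' z) z) ∧ Continuous f' := by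
  have h0 := fun z => (psiD_pos hp 0 z).ne'
  have h1 := fun z => (Q_pos hp 1 z).ne'
  have hρ := hp.ρ_pos.ne'
  have hc := continuous_psiD hp
  have hc' := continuous_Q hp
  refine ⟨_, fun z => ((hasDerivAt_Q hp 0 z).mul
    ((((hasDerivAt_psiD hp 1 z).const_mul (2 * (p.ρ + p.κ))).mul (hasDerivAt_Q hp 1 z)).sub
      (((hasDerivAt_psiD hp 2 z).const_mul p.ρ).mul (hasDerivAt_Qderiv_zero hp z)))).div
    (((hasDerivAt_psiD hp 0 z).const_mul p.ρ).mul ((hasDerivAt_Q hp 1 z).pow 2))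
      (mul_ne_zero (mul_ne_zero hρ (h0 z)) (pow_ne_zero 2 (h1 z))), ?_⟩
  have h2 : Continuous (Qderiv p 0) := IsShiftedBoundary.continuous_Qderiv_zero hp
  have h3 : Continuous (Qderiv p 1) := by unfold Qderiv; fun_prop
  refine Continuous.div (by simp only [Pi.mul_apply, Pi.sub_apply]; fun_prop) (by fun_prop)
    fun z => ?_
  exact pow_ne_zero 2 (mul_ne_zero (mul_ne_zero hρ (h0 z)) (pow_ne_zero 2 (h1 z)))

lemma exists_hasDerivAt_ratioQ (hp : p.Admissible) :
    ∃ f', (∀ z, HasDerivAt (ratioQ p) (f' z) z) ∧ Continuous f' := by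
  have h1 := fun z => (Q_pos hp 1 z).ne'
  have hc := continuous_psiD hp
  have hc' := continuous_Q hp
  refine ⟨_, hasDerivAt_ratioQ hp, ?_⟩
  have h2 : Continuous (Qderiv p 0) := IsShiftedBoundary.continuous_Qderiv_zero hp
  refine Continuous.neg (Continuous.div ?_ (by fun_prop) fun z => pow_ne_zero 2 (h1 z))
  unfold hankel
  fun_prop

/-- A solution of a scalar equation with a bounded, uniformly Lipschitz right-hand side, with
given terminal value. -/
lemma exists_terminal_solution {V : ℝ → ℝ → ℝ} {T K B : ℝ} (hT : 0 ≤ T)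
    (hlip : ∀ y ∈ Icc 0 T, ∀ a b, |V y a - V y b| ≤ K * |a - b|)
    (hcont : ∀ z, ContinuousOn (fun y => V y z) (Icc 0 T))
    (hbd : ∀ y ∈ Icc 0 T, ∀ z, |V y z| ≤ B) (z₀ : ℝ) :
    ∃ z : ℝ → ℝ, z T = z₀ ∧
      ∀ y ∈ Icc 0 T, HasDerivWithinAt z (V y (z y)) (Icc 0 T) y := by
  have hPL : IsPicardLindelof V (tmin := 0) (tmax := T) ⟨T, right_mem_Icc.2 hT⟩ z₀
      -- A ball of radius `B · T` cannot be left within time `T`, so the local theorem yields a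
      -- solution on all of `[0, T]`.
      (B.toNNReal * T.toNNReal) 0 B.toNNReal K.toNNReal :=
    { lipschitzOnWith := fun y hy => LipschitzOnWith.of_dist_le_mul fun a _ b _ => by
        rw [Real.dist_eq, Real.dist_eq]
        exact (hlip y hy a b).trans
          (mul_le_mul_of_nonneg_right (Real.le_coe_toNNReal K) (abs_nonneg _))
      continuousOn := fun z _ => hcont z
      norm_le := fun y hy z _ => (hbd y hy z).trans (Real.le_coe_toNNReal B)
      mul_max_le := by simp [hT] }
  exact hPL.exists_eq_forall_mem_Icc_hasDerivWithinAt₀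

lemma exists_H_eq_zero (hp : p.Admissible) : ∃ z, H p z = 0 := by
  have hρκ : 0 < p.ρ + p.κ := add_pos hp.ρ_pos hp.κ_pos
  have hcont : Continuous fun z => defect p p.ymax z := by
    have : Continuous (gap p p.ymax) :=
      continuous_iff_continuousAt.2 fun z => (hasDerivAt_gap hp p.ymax z).continuousAt
    exact (this.mul (continuous_psiD hp 1)).add (continuous_psiD hp 0)
  set z₀ := (p.ρ + p.κ) * p.c - p.μ * p.κ / p.ρ + p.β * (p.ρ + 2 * p.κ) / p.ρ * p.ymax with hz₀
  have hg : ∀ z, gap p p.ymax z = z₀ - z := fun z => by rw [gap_eq hp, hz₀]; ring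
  have h0 : 0 ≤ defect p p.ymax z₀ := by
    rw [defect, hg, sub_self, zero_mul, zero_add]
    exact (psiD_pos hp 0 z₀).le
  -- The gap vanishes at `z₀` and equals `-r` at `z₀ + r`. Since `ψ/ψ'` decreases, `ψ ≤ rψ'` there,
  -- which makes the defect `≤ 0`.
  set r := psiD p 0 z₀ / psiD p 1 z₀ with hr
  have hrpos : 0 < r := div_pos (psiD_pos hp 0 z₀) (psiD_pos hp 1 z₀)
  have h1 : defect p p.ymax (z₀ + r) ≤ 0 := by
    have hle := (antitone_psiD_div hp 0).antitone (show z₀ ≤ z₀ + r by linarith)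
    simp only [zero_add] at hle
    rw [div_le_iff₀ (psiD_pos hp 1 _), ← hr] at hle
    rw [defect, hg]
    linarith
  obtain ⟨z, -, hz⟩ := intermediate_value_Icc' (show z₀ ≤ z₀ + r by linarith)
    hcont.continuousOn (⟨h1, h0⟩ : (0 : ℝ) ∈ Icc _ _)
  refine ⟨z, ?_⟩
  have := H_eq_defect hp z
  exact (mul_eq_zero.1 (this.trans hz)).resolve_left hρκ.ne'

/-- A nonpositive defect forces a negative gap. The resulting lower bound does not depend on `y` and
confines the solution to a compact interval. -/
lemma lt_of_defect_nonpos (hp : p.Admissible) {y z : ℝ} (hy : 0 ≤ y) (h : defect p y z ≤ 0) :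
    (p.ρ + p.κ) * p.c - p.μ * p.κ / p.ρ < z := by
  have h0 := psiD_pos hp 0 z
  have h1 := psiD_pos hp 1 z
  have hg : gap p y z < 0 := by
    by_contra hcon
    push Not at hcon
    have := mul_nonneg hcon h1.le
    rw [defect] at h
    linarith
  have := mul_nonneg (gapSlope_pos hp).le hy
  rw [gap_eq hp, ← gapSlope] at hg
  linarith

theorem exists_isShiftedBoundary (hp : p.Admissible) : ∃ Ft, IsShiftedBoundary p Ft := by
  have hβ := hp.β_pos
  have hρ := hp.ρ_pos
  have hT := hp.ymax_pos
  obtain ⟨zb, hzb⟩ := exists_H_eq_zero hp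
  have hvb : defect p p.ymax zb = 0 := by rw [← H_eq_defect hp, hzb, mul_zero]
  set a := (p.ρ + p.κ) * p.c - p.μ * p.κ / p.ρ with ha
  have hab : a ≤ zb := (lt_of_defect_nonpos hp hT.le hvb.le).le
  have hne : (Icc a zb).Nonempty := nonempty_Icc.2 hab
  obtain ⟨γ', hγ, hγc⟩ := exists_hasDerivAt_fieldConst hp
  obtain ⟨η', hη, hηc⟩ := exists_hasDerivAt_fieldPole hp
  obtain ⟨G', hG, hGc⟩ := exists_hasDerivAt_ratioQ hp
  have cγ : Continuous (fieldConst p) :=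
    continuous_iff_continuousAt.2 fun z => (hγ z).continuousAt
  have cη : Continuous (fieldPole p) :=
    continuous_iff_continuousAt.2 fun z => (hη z).continuousAt
  have cG : Continuous (ratioQ p) := continuous_iff_continuousAt.2 fun z => (hG z).continuousAt
  obtain ⟨Lγ, hLγ0, hLγ⟩ := exists_lipschitz_Icc hγ hγc a zb
  obtain ⟨Lη, hLη0, hLη⟩ := exists_lipschitz_Icc hη hηc a zb
  obtain ⟨LG, hLG0, hLG⟩ := exists_lipschitz_Icc hG hGc a zb
  obtain ⟨zγ, -, hMγ⟩ := isCompact_Icc.exists_isMaxOn hne cγ.continuousOn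
  obtain ⟨zη, -, hMη⟩ := isCompact_Icc.exists_isMaxOn hne cη.continuousOn
  obtain ⟨zm, -, hmη⟩ := isCompact_Icc.exists_isMinOn hne cη.continuousOn
  -- `χ` where the defect vanishes
  have cχ : Continuous fun z => ratioQ p z - psiD p 0 z / psiD p 1 z :=
    cG.sub ((continuous_psiD hp 0).div (continuous_psiD hp 1) fun z => (psiD_pos hp 1 z).ne')
  obtain ⟨zχ, -, hmχ⟩ := isCompact_Icc.exists_isMinOn hne cχ.continuousOn
  set mχ := ratioQ p zχ - psiD p 0 zχ / psiD p 1 zχ with hmχ_def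
  have hmχ0 : 0 < mχ := by
    have h1 := psiD_pos hp 1 zχ
    have hQ1 := Q_pos hp 1 zχ
    have : mχ = psiD p 2 zχ * Q p 0 zχ / (Q p 1 zχ * psiD p 1 zχ) := by
      rw [hmχ_def, ratioQ]
      field_simp
      linear_combination psiD_mul_Qderiv p zχ
    rw [this]
    exact div_pos (mul_pos (psiD_pos hp 2 _) (Q_pos hp 0 _)) (mul_pos hQ1 h1)
  have hη0 := fieldPole_pos hp zm
  have hs := gapSlope_pos hp
  -- The truncation level: below `mχ`, so that the field is genuine near `v = 0`, and so small that
  -- the pole term `βη/δ` exceeds the slope of the gap, so that the solution cannot cross `χ = δ`.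
  set δ := min mχ (p.β * fieldPole p zm / gapSlope p) / 2 with hδ
  have hmin : 0 < min mχ (p.β * fieldPole p zm / gapSlope p) :=
    lt_min hmχ0 (div_pos (mul_pos hβ hη0) hs)
  have hδ0 : 0 < δ := half_pos hmin
  have hδχ : δ < mχ := (half_lt_self hmin).trans_le (min_le_left _ _)
  have hδη : gapSlope p * δ < p.β * fieldPole p zm := by
    have : δ < p.β * fieldPole p zm / gapSlope p :=
      (half_lt_self hmin).trans_le (min_le_right _ _)
    rw [lt_div_iff₀ hs] at this
    linarith
  -- the regularized vector field
  let pr : ℝ → ℝ := fun z => (projIcc a zb hab z : ℝ)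
  have hpr : ∀ z, pr z ∈ Icc a zb := fun z => (projIcc a zb hab z).2
  have hpr_lip : ∀ s t, |pr s - pr t| ≤ |s - t| := fun s t => by
    have := (LipschitzWith.projIcc hab).dist_le_mul s t
    simpa [Real.dist_eq, Subtype.dist_eq] using this
  have hpr_id : ∀ z ∈ Icc a zb, pr z = z := fun z hz => by
    simp [pr, projIcc_of_mem hab hz]
  let χ : ℝ → ℝ → ℝ := fun y z => gap p y z + ratioQ p z
  let V : ℝ → ℝ → ℝ := fun y z =>
    p.β * (fieldConst p (pr z) + fieldPole p (pr z) / max (χ y (pr z)) δ)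
  have hmaxpos : ∀ y z, 0 < max (χ y z) δ := fun y z => lt_max_of_lt_right hδ0
  have hVpos : ∀ y z, 0 < V y z := fun y z =>
    mul_pos hβ (add_pos (fieldConst_pos hp _) (div_pos (fieldPole_pos hp _) (hmaxpos _ _)))
  have hVbd : ∀ y ∈ Icc 0 p.ymax, ∀ z,
      |V y z| ≤ p.β * (fieldConst p zγ + fieldPole p zη / δ) := fun y _ z => by
    rw [abs_of_pos (hVpos y z)]
    have h1 : fieldConst p (pr z) ≤ fieldConst p zγ := hMγ (hpr z)
    have h2 : fieldPole p (pr z) ≤ fieldPole p zη := hMη (hpr z)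
    have h3 := (fieldPole_pos hp zη).le
    refine mul_le_mul_of_nonneg_left (add_le_add h1 ?_) hβ.le
    exact div_le_div₀ h3 h2 hδ0 (le_max_right _ _)
  have hVcont : ∀ z, ContinuousOn (fun y => V y z) (Icc 0 p.ymax) := fun z => by
    refine Continuous.continuousOn (continuous_const.mul (continuous_const.add ?_))
    have hg : Continuous fun y => gap p y (pr z) := by
      simp_rw [gap_eq hp]
      fun_prop
    exact continuous_const.div ((hg.add continuous_const).max continuous_const)
      fun y => (hmaxpos _ _).ne'
  have hVlip : ∀ y ∈ Icc 0 p.ymax, ∀ s t, |V y s - V y t| ≤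
      p.β * (Lγ + (Lη / δ + fieldPole p zη * (1 + LG) / δ ^ 2)) * |s - t| := by
    intro y _ s t
    have hs' := hpr s
    have ht' := hpr t
    set u := max (χ y (pr s)) δ with hu
    set v := max (χ y (pr t)) δ with hv
    have hu0 : δ ≤ u := le_max_right _ _
    have hv0 : δ ≤ v := le_max_right _ _
    have huv : |u - v| ≤ (1 + LG) * |pr s - pr t| := by
      have h1 : |u - v| ≤ |χ y (pr s) - χ y (pr t)| := by
        have := abs_max_sub_max_le_abs (χ y (pr s)) (χ y (pr t)) δ
        exact this
      have h2 : χ y (pr s) - χ y (pr t) =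
          -(pr s - pr t) + (ratioQ p (pr s) - ratioQ p (pr t)) := by
        simp only [χ, gap_eq hp]; ring
      rw [h2] at h1
      refine h1.trans ((abs_add_le _ _).trans ?_)
      rw [abs_neg, add_mul, one_mul]
      gcongr
      exact hLG _ hs' _ ht'
    have hpole0 := fieldPole_pos hp (pr t)
    have hpole : fieldPole p (pr t) ≤ fieldPole p zη := hMη ht'
    have hu1 : 0 < u := hδ0.trans_le hu0
    have hv1 : 0 < v := hδ0.trans_le hv0
    have hsplit : V y s - V y t = p.β * ((fieldConst p (pr s) - fieldConst p (pr t)) +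
        ((fieldPole p (pr s) - fieldPole p (pr t)) / u +
          -(fieldPole p (pr t) * (u - v) / (u * v)))) := by
      simp only [V, ← hu, ← hv]
      field_simp
      ring
    have e1 := hLγ _ hs' _ ht'
    have e2 : |(fieldPole p (pr s) - fieldPole p (pr t)) / u| ≤ Lη * |pr s - pr t| / δ := by
      rw [abs_div, abs_of_pos hu1]
      exact div_le_div₀ (by positivity) (hLη _ hs' _ ht') hδ0 hu0
    have e3 : |-(fieldPole p (pr t) * (u - v) / (u * v))| ≤
        fieldPole p zη * ((1 + LG) * |pr s - pr t|) / δ ^ 2 := by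
      rw [abs_neg, abs_div, abs_mul, abs_of_pos hpole0, abs_of_pos (mul_pos hu1 hv1)]
      have hzη := (fieldPole_pos hp zη).le
      refine div_le_div₀ (by positivity) ?_ (by positivity) ?_
      · exact mul_le_mul hpole huv (abs_nonneg _) hzη
      · rw [sq]; exact mul_le_mul hu0 hv0 hδ0.le hu1.le
    have hzη := (fieldPole_pos hp zη).le
    calc |V y s - V y t| ≤ p.β * (Lγ * |pr s - pr t| + (Lη * |pr s - pr t| / δ
            + fieldPole p zη * ((1 + LG) * |pr s - pr t|) / δ ^ 2)) := by
          rw [hsplit, abs_mul, abs_of_pos hβ]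
          refine mul_le_mul_of_nonneg_left ?_ hβ.le
          refine (abs_add_le _ _).trans (add_le_add e1 ?_)
          exact (abs_add_le _ _).trans (add_le_add e2 e3)
      _ = p.β * (Lγ + (Lη / δ + fieldPole p zη * (1 + LG) / δ ^ 2)) * |pr s - pr t| := by ring
      _ ≤ _ := mul_le_mul_of_nonneg_left (hpr_lip s t) (by positivity)
  obtain ⟨z, hzT, hz⟩ := exists_terminal_solution hT.le hVlip hVcont hVbd zb
  -- The truncated field is positive, so the solution increases to its terminal value.
  have hle : ∀ y ∈ Icc 0 p.ymax, z y ≤ zb := by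
    have := nonpos_of_deriv_pos_at_zeros (f := fun y => z y - zb)
      (fun y hy => (hz y hy).sub_const zb) (by simp [hzT]) fun y _ _ => hVpos _ _
    intro y hy
    linarith [this y hy]
  have hVeq : ∀ y, ∀ s ∈ Icc a zb, δ ≤ χ y s →
      V y s = p.β * (ODEnum p y s / ODEden p y s) := fun y s hs' hχ => by
    have h1 : χ y s ≠ 0 := (hδ0.trans_le hχ).ne'
    simp only [V, hpr_id s hs', max_eq_left hχ]
    rw [ODEnum_div_ODEden hp h1]
  have hχ_of_defect : ∀ y, ∀ s ∈ Icc a zb, defect p y s = 0 → δ < χ y s := by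
    intro y s hs' h0
    have h1 := psiD_pos hp 1 s
    have hg : gap p y s = -(psiD p 0 s / psiD p 1 s) := by
      rw [defect] at h0
      field_simp
      linarith
    have h2 : mχ ≤ ratioQ p s - psiD p 0 s / psiD p 1 s := hmχ hs'
    simp only [χ]
    rw [hg]
    linarith
  -- At a zero of the defect one has `χ > δ`, so the true equation holds and the defect increases
  -- through that zero.
  have hdefect : ∀ y ∈ Icc 0 p.ymax, defect p y (z y) ≤ 0 := by
    refine nonpos_of_deriv_pos_at_zeros (fun y hy => hasDerivWithinAt_defect_comp hp (hz y hy))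
      (by rw [hzT, hvb]) fun y hy h0 => ?_
    have hmem : z y ∈ Icc a zb := ⟨(lt_of_defect_nonpos hp hy.1 h0.le).le, hle y hy⟩
    have hD := (ODEden_pos_of_defect_eq_zero hp h0).ne'
    have hq : V y (z y) * ODEden p y (z y) = p.β * ODEnum p y (z y) := by
      rw [hVeq y _ hmem (hχ_of_defect y _ hmem h0).le]
      field_simp
    have hQ := Q_pos hp 0 (z y)
    have key := Q_mul_deriv_defect hp hq
    rw [h0, zero_mul, zero_mul, add_zero] at key
    have hneg : gap p y (z y) * psiD p 2 (z y) + psiD p 1 (z y) < 0 := by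
      by_contra hcon
      push Not at hcon
      exact absurd (div_nonneg hcon (mul_pos (add_pos hp.ρ_pos hp.κ_pos) hQ).le)
        (not_le.2 (slopeA_neg hp h0.le))
    refine pos_of_mul_pos_right (a := Q p 0 (z y)) ?_ hQ.le
    rw [key]
    have := mul_pos (mul_pos hβ hQ) (neg_pos.2 hneg)
    linarith
  have hmem : ∀ y ∈ Icc 0 p.ymax, z y ∈ Icc a zb := fun y hy =>
    ⟨(lt_of_defect_nonpos hp hy.1 (hdefect y hy)).le, hle y hy⟩
  -- Where `χ = δ`, the field exceeds the slope of the gap and `Q_0'/Q_1` decreases along the curve,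
  -- so `δ - χ` has positive derivative; the barrier lemma applies again.
  have hχ : ∀ y ∈ Icc 0 p.ymax, δ ≤ χ y (z y) := by
    have hd : ∀ y ∈ Icc 0 p.ymax, HasDerivWithinAt (fun y => δ - χ y (z y))
        (V y (z y) - gapSlope p +
          psiD p 2 (z y) * hankel p 0 (z y) / Q p 1 (z y) ^ 2 * V y (z y)) (Icc 0 p.ymax) y := by
      intro y hy
      refine (((hasDerivWithinAt_gap_comp hp (hz y hy)).add
        ((hasDerivAt_ratioQ hp (z y)).comp_hasDerivWithinAt y (hz y hy))).const_sub δ).congr_deriv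
          ?_
      ring
    have := nonpos_of_deriv_pos_at_zeros hd (by
      have := hχ_of_defect p.ymax zb (right_mem_Icc.2 hab) hvb
      rw [hzT]; linarith) fun y hy h0 => ?_
    · intro y hy
      linarith [this y hy]
    · have h1 : χ y (z y) = δ := by linarith
      have hV : V y (z y) = p.β * (fieldConst p (z y) + fieldPole p (z y) / δ) := by
        simp only [V, hpr_id _ (hmem y hy), h1, max_self]
      have h2 : fieldPole p zm ≤ fieldPole p (z y) := hmη (hmem y hy)
      have h3 : gapSlope p < V y (z y) := by
        have h4 : gapSlope p < p.β * fieldPole p (z y) / δ := by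
          rw [lt_div_iff₀ hδ0]
          exact hδη.trans_le (mul_le_mul_of_nonneg_left h2 hβ.le)
        have h5 := mul_pos hβ (fieldConst_pos hp (z y))
        rw [hV, mul_add, ← mul_div_assoc]
        linarith
      have h6 : 0 < psiD p 2 (z y) * hankel p 0 (z y) / Q p 1 (z y) ^ 2 * V y (z y) :=
        mul_pos (div_pos (mul_pos (psiD_pos hp 2 _) (hankel_pos hp 0 _))
          (pow_pos (Q_pos hp 1 _) 2)) (hVpos _ _)
      linarith
  refine ⟨z, by rw [hzT, hzb], fun y hy => ?_, fun y hy => ?_⟩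
  · rw [ODEden_eq_mul hp]
    exact (mul_pos (mul_pos (psiD_pos hp 0 _) (Q_pos hp 1 _)) (hδ0.trans_le (hχ y hy))).ne'
  · rw [← hVeq y _ (hmem y hy) (hχ y hy)]
    exact hz y hy

end Existence

/-! ### An envelope lemma -/

section Envelope

/-- Along a curve `B`, Lipschitz at `x₀`, that is locally constant or runs into a critical point
of `g x₀`, only the partial derivative in the first variable matters. -/
lemma hasDerivAt_envelope {g gx : ℝ → ℝ → ℝ} {S : Set ℝ} {B : ℝ → ℝ} {x₀ K : ℝ}
    (hB : ∀ x, B x ∈ S) (hg : ∀ x, ∀ t ∈ S, HasDerivAt (fun s => g s t) (gx x t) x)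
    (hgx : ContinuousOn (fun q : ℝ × ℝ => gx q.1 q.2) (univ ×ˢ S))
    (hBL : ∀ x, |B x - B x₀| ≤ K * |x - x₀|)
    (h : (∀ᶠ x in 𝓝 x₀, B x = B x₀) ∨ HasDerivWithinAt (g x₀) 0 S (B x₀)) :
    HasDerivAt (fun x => g x (B x)) (gx x₀ (B x₀)) x₀ := by
  have hBO : (fun x => B x - B x₀) =O[𝓝 x₀] fun x => x - x₀ :=
    Asymptotics.IsBigO.of_bound K (Eventually.of_forall hBL)
  have hBc : Tendsto B (𝓝 x₀) (𝓝[S] (B x₀)) := by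
    refine tendsto_nhdsWithin_iff.2 ⟨?_, Eventually.of_forall hB⟩
    have h0 : Tendsto (fun x => B x - B x₀) (𝓝 x₀) (𝓝 0) :=
      hBO.trans_tendsto (by simpa using (tendsto_id (x := 𝓝 x₀)).sub_const x₀)
    simpa using h0.add_const (B x₀)
  -- Moving only the second variable costs `o(x - x₀)`: either `B` does not move, or it moves by
  -- `O(x - x₀)` from a critical point.
  have h2 : (fun x => g x₀ (B x) - g x₀ (B x₀)) =o[𝓝 x₀] fun x => x - x₀ := by
    rcases h with h | h
    · refine (Asymptotics.isLittleO_zero _ _).congr' ?_ EventuallyEq.rfl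
      filter_upwards [h] with x hx
      rw [hx, sub_self]
    · have h' := hasDerivWithinAt_iff_isLittleO.1 h
      simp only [smul_zero, sub_zero] at h'
      exact (h'.comp_tendsto hBc).trans_isBigO hBO
  -- Moving only the first variable: mean value inequality along `s ↦ g s (B x)`, uniform in `B x`
  -- by joint continuity of `gx`.
  have h1 : (fun x => g x (B x) - g x₀ (B x) - (x - x₀) * gx x₀ (B x₀)) =o[𝓝 x₀]
      fun x => x - x₀ := by
    refine Asymptotics.isLittleO_iff.2 fun ε hε => ?_
    have hc := hgx (x₀, B x₀) ⟨mem_univ _, hB x₀⟩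
    have hev := Metric.continuousWithinAt_iff.1 hc ε hε
    obtain ⟨r, hr, hball⟩ := hev
    have hBr : ∀ᶠ x in 𝓝 x₀, dist (B x) (B x₀) < r :=
      (tendsto_nhdsWithin_iff.1 hBc).1 (Metric.ball_mem_nhds _ hr)
    filter_upwards [hBr, Metric.ball_mem_nhds x₀ hr] with x hx hxr
    have hmv := (convex_ball x₀ r).norm_image_sub_le_of_norm_hasDerivWithin_le
      (f := fun s => g s (B x) - s * gx x₀ (B x₀)) (f' := fun s => gx s (B x) - gx x₀ (B x₀))
      (C := ε) (fun s _ => by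
        have := (hg s (B x) (hB x)).sub ((hasDerivAt_id s).mul_const (gx x₀ (B x₀)))
        rw [one_mul] at this
        exact this.hasDerivWithinAt) (fun s hs => by
        have := hball (x := (s, B x)) ⟨mem_univ _, hB x⟩ (by
          rw [Prod.dist_eq]; exact max_lt hs hx)
        rw [Real.dist_eq] at this
        exact this.le) (Metric.mem_ball_self hr) hxr
    refine le_trans (le_of_eq ?_) hmv
    congr 1
    ring
  refine hasDerivAt_iff_isLittleO.2 ((h1.add h2).congr_left fun x => ?_)
  simp only [smul_eq_mul]
  ring

end Envelope

/-! ### The candidate in the waiting region -/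

section Waiting

variable {p : Params} {Ft : ℝ → ℝ}

/-- `A(t) ψ(x + β t) + R(x, t)`. -/
noncomputable def waitValue (p : Params) (Ft : ℝ → ℝ) (x t : ℝ) : ℝ :=
  coeffA p Ft t * psiD p 0 (x + p.β * t) + profit p x t

/-- The `x`-derivative of `waitValue`. -/
noncomputable def waitX (p : Params) (Ft : ℝ → ℝ) (x t : ℝ) : ℝ :=
  coeffA p Ft t * psiD p 1 (x + p.β * t) + t / (p.ρ + p.κ)

/-- The second `x`-derivative of `waitValue`. -/
noncomputable def waitXX (p : Params) (Ft : ℝ → ℝ) (x t : ℝ) : ℝ :=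
  coeffA p Ft t * psiD p 2 (x + p.β * t)

/-- The `t`-derivative of `waitValue`. -/
noncomputable def waitY (p : Params) (Ft : ℝ → ℝ) (x t : ℝ) : ℝ :=
  slopeA p t (Ft t) * psiD p 0 (x + p.β * t) + p.β * coeffA p Ft t * psiD p 1 (x + p.β * t)
    + Rtilde p (x + p.β * t) t

/-- The mixed derivative of `waitValue`. -/
noncomputable def waitXY (p : Params) (Ft : ℝ → ℝ) (x t : ℝ) : ℝ :=
  slopeA p t (Ft t) * psiD p 1 (x + p.β * t) + p.β * coeffA p Ft t * psiD p 2 (x + p.β * t)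
    + 1 / (p.ρ + p.κ)

lemma hasDerivAt_psiD_shift (hp : p.Admissible) (k : ℕ) (x t : ℝ) :
    HasDerivAt (fun s => psiD p k (s + p.β * t)) (psiD p (k + 1) (x + p.β * t)) x :=
  (hasDerivAt_psiD hp k _).comp_add_const x (p.β * t)

lemma hasDerivAt_psiD_shift_level (hp : p.Admissible) (k : ℕ) (x t : ℝ) :
    HasDerivAt (fun s => psiD p k (x + p.β * s)) (psiD p (k + 1) (x + p.β * t) * p.β) t := by
  have h : HasDerivAt (fun s => x + p.β * s) p.β t := by
    simpa using ((hasDerivAt_id t).const_mul p.β).const_add x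
  exact (hasDerivAt_psiD hp k _).comp t h

lemma hasDerivAt_waitValue (hp : p.Admissible) (x t : ℝ) :
    HasDerivAt (fun s => waitValue p Ft s t) (waitX p Ft x t) x := by
  have h : HasDerivAt (fun s => profit p s t) (t / (p.ρ + p.κ)) x := by
    refine ((((hasDerivAt_id x).div_const (p.ρ + p.κ)).add_const
      (p.κ * (p.μ - p.β * t) / (p.ρ * (p.ρ + p.κ)))).const_mul t).congr_deriv ?_
    ring
  exact ((hasDerivAt_psiD_shift hp 0 x t).const_mul _).add h

lemma hasDerivAt_waitX (hp : p.Admissible) (x t : ℝ) :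
    HasDerivAt (fun s => waitX p Ft s t) (waitXX p Ft x t) x :=
  ((hasDerivAt_psiD_shift hp 1 x t).const_mul _).add_const _

lemma IsShiftedBoundary.hasDerivWithinAt_waitValue (hF : IsShiftedBoundary p Ft)
    (hp : p.Admissible) (x : ℝ) : ∀ t ∈ Icc 0 p.ymax,
    HasDerivWithinAt (waitValue p Ft x) (waitY p Ft x t) (Icc 0 p.ymax) t := by
  intro t ht
  have hρ := hp.ρ_pos.ne'
  have hρκ : p.ρ + p.κ ≠ 0 := (add_pos hp.ρ_pos hp.κ_pos).ne'
  have h : HasDerivAt (fun s => profit p x s) (Rtilde p (x + p.β * t) t) t := by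
    have h1 := ((((hasDerivAt_id t).const_mul p.β).const_sub p.μ).const_mul p.κ).div_const
      (p.ρ * (p.ρ + p.κ))
    refine ((hasDerivAt_id t).mul (h1.const_add (x / (p.ρ + p.κ)))).congr_deriv ?_
    simp only [id, Rtilde]
    field_simp
    ring
  refine (((hF.hasDerivWithinAt_coeffA hp t ht).mul
    (hasDerivAt_psiD_shift_level hp 0 x t).hasDerivWithinAt).add
      h.hasDerivWithinAt).congr_deriv ?_
  rw [waitY]
  ring

lemma IsShiftedBoundary.hasDerivWithinAt_waitX (hF : IsShiftedBoundary p Ft)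
    (hp : p.Admissible) (x : ℝ) : ∀ t ∈ Icc 0 p.ymax,
    HasDerivWithinAt (waitX p Ft x) (waitXY p Ft x t) (Icc 0 p.ymax) t := by
  intro t ht
  refine (((hF.hasDerivWithinAt_coeffA hp t ht).mul
    (hasDerivAt_psiD_shift_level hp 1 x t).hasDerivWithinAt).add
      ((hasDerivAt_id t).div_const (p.ρ + p.κ)).hasDerivWithinAt).congr_deriv ?_
  rw [waitXY]
  ring

lemma waitY_boundary (hp : p.Admissible) (t : ℝ) :
    waitY p Ft (boundary p Ft t) t = p.c := by
  have hρκ : p.ρ + p.κ ≠ 0 := (add_pos hp.ρ_pos hp.κ_pos).ne'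
  have h := slopeA_system_value hp Ft t
  rw [gap, mul_div_cancel_left₀ _ hρκ] at h
  rw [waitY, boundary, sub_add_cancel, h]
  ring

lemma waitXY_boundary (hp : p.Admissible) (t : ℝ) :
    waitXY p Ft (boundary p Ft t) t = 0 := by
  rw [waitXY, boundary, sub_add_cancel, slopeA_system_deriv hp]
  ring

/-- `ψ(x + βt)` absorbs the drift shift `-βt`, and the profit is a particular solution for the
source `xt`. -/
lemma waitValue_ode (hp : p.Admissible) (x t : ℝ) :
    1 / 2 * p.σ ^ 2 * waitXX p Ft x t + p.κ * ((p.μ - p.β * t) - x) * waitX p Ft x t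
      - p.ρ * waitValue p Ft x t + x * t = 0 := by
  have hρ := hp.ρ_pos.ne'
  have hρκ : p.ρ + p.κ ≠ 0 := (add_pos hp.ρ_pos hp.κ_pos).ne'
  have h := psiD_ode hp 0 (x + p.β * t)
  simp only [zero_add, Nat.cast_zero, zero_mul, add_zero] at h
  have h1 : p.κ * ((p.μ - p.β * t) - x) * (t / (p.ρ + p.κ)) - p.ρ * profit p x t + x * t = 0 := by
    rw [profit]
    field_simp
    ring
  rw [waitXX, waitX, waitValue]
  linear_combination coeffA p Ft t * h + h1

/-- In the waiting region the marginal value of installation is at most its cost. -/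
lemma IsShiftedBoundary.waitY_le (hF : IsShiftedBoundary p Ft) (hp : p.Admissible) {x t : ℝ}
    (ht : t ∈ Icc 0 p.ymax) (hx : x ≤ boundary p Ft t) : waitY p Ft x t ≤ p.c := by
  have hA := hF.coeffA_nonneg hp t ht
  have hconc := slopeA_system_concave hp Ft (hF.ODEden_pos hp t ht)
  have hβ := hp.β_pos
  set b := boundary p Ft t with hb
  have hbF : b + p.β * t = Ft t := by rw [hb, boundary]; ring
  have hd1 : ∀ s, HasDerivAt (fun s => waitY p Ft s t) (waitXY p Ft s t) s := fun s => by
    have h : HasDerivAt (fun s => Rtilde p (s + p.β * t) t) (1 / (p.ρ + p.κ)) s := by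
      have hρ := hp.ρ_pos.ne'
      have hρκ : p.ρ + p.κ ≠ 0 := (add_pos hp.ρ_pos hp.κ_pos).ne'
      refine ((((((hasDerivAt_id s).add_const (p.β * t)).const_mul p.ρ).const_add
        (p.μ * p.κ)).sub_const (p.β * (p.ρ + 2 * p.κ) * t)).div_const
          (p.ρ * (p.ρ + p.κ))).congr_deriv ?_
      field_simp
    exact (((hasDerivAt_psiD_shift hp 0 s t).const_mul _).add
      ((hasDerivAt_psiD_shift hp 1 s t).const_mul _)).add h
  have hd2 : ∀ s, HasDerivAt (fun s => waitXY p Ft s t)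
      (slopeA p t (Ft t) * psiD p 2 (s + p.β * t)
        + p.β * coeffA p Ft t * psiD p 3 (s + p.β * t)) s := fun s =>
    (((hasDerivAt_psiD_shift hp 1 s t).const_mul _).add
      ((hasDerivAt_psiD_shift hp 2 s t).const_mul _)).add_const _
  -- The sign of `w_yxx` spreads from the boundary to its left: `A ≥ 0` and `ψ''/ψ'''` is
  -- decreasing. Hence `w_xy` decreases to its boundary value `0`, and `w_y` increases to `c`.
  have hneg : ∀ s, s ≤ b → slopeA p t (Ft t) * psiD p 2 (s + p.β * t)
        + p.β * coeffA p Ft t * psiD p 3 (s + p.β * t) ≤ 0 := fun s hs => by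
    have h2 := psiD_pos hp 2 (s + p.β * t)
    have h3 := psiD_pos hp 3 (s + p.β * t)
    have h2' := psiD_pos hp 2 (Ft t)
    have h3' := psiD_pos hp 3 (Ft t)
    have hle : s + p.β * t ≤ Ft t := by linarith
    have hanti := (antitone_psiD_div hp 2).antitone hle
    simp only [Nat.reduceAdd] at hanti
    rw [div_le_div_iff₀ h3' h3] at hanti
    have h4 : psiD p 2 (Ft t) * (slopeA p t (Ft t) * psiD p 2 (s + p.β * t)
        + p.β * coeffA p Ft t * psiD p 3 (s + p.β * t)) ≤ 0 := by
      nlinarith [mul_le_mul_of_nonneg_left hanti (mul_nonneg hβ.le hA),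
        mul_neg_of_neg_of_pos hconc h2]
    by_contra hcon
    push Not at hcon
    have := mul_pos h2' hcon
    linarith
  have hanti : AntitoneOn (fun s => waitXY p Ft s t) (Iic b) :=
    antitoneOn_of_deriv_nonpos (convex_Iic b)
      (fun s _ => (hd2 s).continuousAt.continuousWithinAt)
      (fun s _ => (hd2 s).differentiableAt.differentiableWithinAt) fun s hs => by
        rw [interior_Iic] at hs
        rw [(hd2 s).deriv]
        exact hneg s (le_of_lt hs)
  have hmono : MonotoneOn (fun s => waitY p Ft s t) (Iic b) :=
    monotoneOn_of_deriv_nonneg (convex_Iic b)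
      (fun s _ => (hd1 s).continuousAt.continuousWithinAt)
      (fun s _ => (hd1 s).differentiableAt.differentiableWithinAt) fun s hs => by
        rw [interior_Iic] at hs
        rw [(hd1 s).deriv, ← waitXY_boundary (Ft := Ft) hp t]
        exact hanti (mem_Iic.2 (le_of_lt hs)) self_mem_Iic (le_of_lt hs)
  have := hmono hx (self_mem_Iic (a := b)) hx
  simp only [hb, waitY_boundary hp] at this
  exact this

/-- By the equations of `ψ` and `ψ'` and the smooth-fit system, this bracket is `σ²/2` times `w_yxx`
on the boundary. -/
lemma IsShiftedBoundary.installation_bracket (hF : IsShiftedBoundary p Ft) (hp : p.Admissible)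
    {t : ℝ} (ht : t ∈ Icc 0 p.ymax) :
    p.κ * p.β * waitX p Ft (boundary p Ft t) t + p.ρ * p.c - boundary p Ft t < 0 := by
  have hσ := hp.σ_pos
  have hρκ : p.ρ + p.κ ≠ 0 := (add_pos hp.ρ_pos hp.κ_pos).ne'
  have hρ := hp.ρ_pos.ne'
  have hconc := slopeA_system_concave hp Ft (hF.ODEden_pos hp t ht)
  have h0 := psiD_ode hp 0 (Ft t)
  have h1 := psiD_ode hp 1 (Ft t)
  have hv := slopeA_system_value hp Ft t
  have hd := slopeA_system_deriv hp Ft t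
  push_cast at h0 h1
  norm_num at h0 h1
  have hg : p.ρ * (gap p t (Ft t) / (p.ρ + p.κ)) = p.ρ * p.c -
      (p.μ * p.κ + p.ρ * Ft t - p.β * (p.ρ + 2 * p.κ) * t) / (p.ρ + p.κ) := by
    rw [gap, Rtilde]
    field_simp
  have hlin : p.κ * p.β * (t / (p.ρ + p.κ)) + p.ρ * p.c - (Ft t - p.β * t) =
      p.ρ * (gap p t (Ft t) / (p.ρ + p.κ)) - p.κ * (Ft t - p.μ) * (1 / (p.ρ + p.κ)) := by
    rw [hg]
    field_simp
    ring
  have key : p.κ * p.β * waitX p Ft (boundary p Ft t) t + p.ρ * p.c - boundary p Ft t =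
      p.σ ^ 2 / 2 * (slopeA p t (Ft t) * psiD p 2 (Ft t)
        + p.β * coeffA p Ft t * psiD p 3 (Ft t)) := by
    rw [waitX, boundary, sub_add_cancel]
    linear_combination hlin - slopeA p t (Ft t) * h0 - p.β * coeffA p Ft t * h1
      - p.ρ * hv - p.κ * (Ft t - p.μ) * hd
  rw [key]
  exact mul_neg_of_pos_of_neg (by positivity) hconc

lemma continuousOn_mul_psiD (hp : p.Admissible) {f : ℝ → ℝ} (hf : ContinuousOn f (Icc 0 p.ymax))
    (k : ℕ) : ContinuousOn (fun q : ℝ × ℝ => f q.2 * psiD p k (q.1 + p.β * q.2))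
      (univ ×ˢ Icc 0 p.ymax) := by
  have h1 : ContinuousOn (fun q : ℝ × ℝ => f q.2) (univ ×ˢ Icc 0 p.ymax) :=
    hf.comp continuousOn_snd fun q hq => hq.2
  have h2 := continuous_psiD hp k
  exact h1.mul (Continuous.continuousOn (by fun_prop))

lemma IsShiftedBoundary.continuousOn_coeffA (hF : IsShiftedBoundary p Ft) (hp : p.Admissible) :
    ContinuousOn (coeffA p Ft) (Icc 0 p.ymax) :=
  fun t ht => (hF.hasDerivWithinAt_coeffA hp t ht).continuousWithinAt

lemma IsShiftedBoundary.continuousOn_slopeA (hF : IsShiftedBoundary p Ft) (hp : p.Admissible) :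
    ContinuousOn (fun t => slopeA p t (Ft t)) (Icc 0 p.ymax) := by
  refine ContinuousOn.div (((hF.continuousOn_gap hp).mul
    (hF.continuousOn_comp (continuous_psiD hp 2))).add
      (hF.continuousOn_comp (continuous_psiD hp 1)))
    (continuousOn_const.mul (hF.continuousOn_comp (continuous_Q hp 0))) fun t _ => ?_
  exact (mul_pos (add_pos hp.ρ_pos hp.κ_pos) (Q_pos hp 0 _)).ne'

lemma IsShiftedBoundary.continuousOn_waitValue (hF : IsShiftedBoundary p Ft)
    (hp : p.Admissible) : ContinuousOn (fun q : ℝ × ℝ => waitValue p Ft q.1 q.2)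
      (univ ×ˢ Icc 0 p.ymax) := by
  refine (continuousOn_mul_psiD hp (hF.continuousOn_coeffA hp) 0).add ?_
  unfold profit
  exact Continuous.continuousOn (by fun_prop)

lemma IsShiftedBoundary.continuousOn_waitX (hF : IsShiftedBoundary p Ft)
    (hp : p.Admissible) : ContinuousOn (fun q : ℝ × ℝ => waitX p Ft q.1 q.2)
      (univ ×ˢ Icc 0 p.ymax) :=
  (continuousOn_mul_psiD hp (hF.continuousOn_coeffA hp) 1).add
    (Continuous.continuousOn (by fun_prop))

lemma IsShiftedBoundary.continuousOn_waitXX (hF : IsShiftedBoundary p Ft)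
    (hp : p.Admissible) : ContinuousOn (fun q : ℝ × ℝ => waitXX p Ft q.1 q.2)
      (univ ×ˢ Icc 0 p.ymax) :=
  continuousOn_mul_psiD hp (hF.continuousOn_coeffA hp) 2

lemma IsShiftedBoundary.continuousOn_waitY (hF : IsShiftedBoundary p Ft)
    (hp : p.Admissible) : ContinuousOn (fun q : ℝ × ℝ => waitY p Ft q.1 q.2)
      (univ ×ˢ Icc 0 p.ymax) := by
  refine ((continuousOn_mul_psiD hp (hF.continuousOn_slopeA hp) 0).add
    (continuousOn_mul_psiD hp (f := fun t => p.β * coeffA p Ft t)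
      (continuousOn_const.mul (hF.continuousOn_coeffA hp)) 1)).add ?_
  unfold Rtilde
  exact Continuous.continuousOn (by fun_prop)

end Waiting

/-! ### The optimal level -/

section Level

variable {p : Params} {Ft : ℝ → ℝ}

/-- The inverse of the free boundary, extended by `0` on the left and by `ymax` on the right. -/
noncomputable def target (p : Params) (Ft : ℝ → ℝ) (x : ℝ) : ℝ :=
  boundaryInv p Ft (max (boundary p Ft 0) (min (boundary p Ft p.ymax) x))

/-- The level reached after the immediate installation at `(x, y)`. -/
noncomputable def level (p : Params) (Ft : ℝ → ℝ) (x y : ℝ) : ℝ := max y (target p Ft x)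

namespace IsShiftedBoundary

lemma boundary_zero_le (hF : IsShiftedBoundary p Ft) (hp : p.Admissible) :
    boundary p Ft 0 ≤ boundary p Ft p.ymax :=
  (hF.strictMonoOn_boundary hp).monotoneOn (left_mem_Icc.2 hp.ymax_pos.le)
    (right_mem_Icc.2 hp.ymax_pos.le) hp.ymax_pos.le

lemma continuousOn_boundary (hF : IsShiftedBoundary p Ft) :
    ContinuousOn (boundary p Ft) (Icc 0 p.ymax) :=
  fun y hy => (hF.hasDerivWithinAt_boundary y hy).continuousWithinAt

lemma target_spec (hF : IsShiftedBoundary p Ft) (hp : p.Admissible)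
    (x : ℝ) : target p Ft x ∈ Icc 0 p.ymax ∧
    boundary p Ft (target p Ft x) =
      max (boundary p Ft 0) (min (boundary p Ft p.ymax) x) := by
  have hle := hF.boundary_zero_le hp
  obtain ⟨t, ht, hx⟩ := intermediate_value_Icc hp.ymax_pos.le hF.continuousOn_boundary
    (⟨le_max_left _ _, max_le hle (min_le_left _ _)⟩ :
      max (boundary p Ft 0) (min (boundary p Ft p.ymax) x) ∈ Icc _ _)
  exact ⟨Function.invFunOn_mem ⟨t, ht, hx⟩, Function.invFunOn_eq ⟨t, ht, hx⟩⟩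

lemma target_le (hF : IsShiftedBoundary p Ft) (hp : p.Admissible)
    {x t : ℝ} (ht : t ∈ Icc 0 p.ymax) (hx : x ≤ boundary p Ft t) :
    target p Ft x ≤ t := by
  obtain ⟨h1, h2⟩ := hF.target_spec hp x
  refine ((hF.strictMonoOn_boundary hp).le_iff_le h1 ht).1 ?_
  rw [h2]
  exact max_le ((hF.strictMonoOn_boundary hp).monotoneOn (left_mem_Icc.2 hp.ymax_pos.le) ht ht.1)
    ((min_le_right _ _).trans hx)

lemma le_target (hF : IsShiftedBoundary p Ft) (hp : p.Admissible)
    {x t : ℝ} (ht : t ∈ Icc 0 p.ymax) (hx : boundary p Ft t ≤ x) :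
    t ≤ target p Ft x := by
  obtain ⟨h1, h2⟩ := hF.target_spec hp x
  refine ((hF.strictMonoOn_boundary hp).le_iff_le ht h1).1 ?_
  rw [h2]
  exact le_max_of_le_right (le_min ((hF.strictMonoOn_boundary hp).monotoneOn ht
    (right_mem_Icc.2 hp.ymax_pos.le) ht.2) hx)

lemma target_eq_ymax (hF : IsShiftedBoundary p Ft) (hp : p.Admissible)
    {x : ℝ} (hx : boundary p Ft p.ymax ≤ x) : target p Ft x = p.ymax :=
  le_antisymm (hF.target_spec hp x).1.2 (hF.le_target hp (right_mem_Icc.2 hp.ymax_pos.le) hx)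

lemma boundary_target (hF : IsShiftedBoundary p Ft) (hp : p.Admissible)
    {x : ℝ} (h0 : boundary p Ft 0 ≤ x) (h1 : x ≤ boundary p Ft p.ymax) :
    boundary p Ft (target p Ft x) = x := by
  rw [(hF.target_spec hp x).2, min_eq_right h1, max_eq_right h0]

/-- The inverse of a map expanding distances by `m` is `1/m`-Lipschitz, and clamping is
nonexpansive. The envelope lemma needs this bound. -/
lemma exists_target_lipschitz (hF : IsShiftedBoundary p Ft) (hp : p.Admissible) :
    ∃ K, ∀ x x', |target p Ft x - target p Ft x'| ≤ K * |x - x'| := by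
  obtain ⟨m, hm, hexp⟩ := hF.exists_expansion hp
  have hle : ∀ s ∈ Icc 0 p.ymax, ∀ t ∈ Icc 0 p.ymax,
      m * |s - t| ≤ |boundary p Ft s - boundary p Ft t| := by
    intro s hs t ht
    rcases le_total s t with h | h
    · rw [abs_sub_comm s t, abs_of_nonneg (sub_nonneg.2 h), abs_sub_comm]
      exact (hexp s hs t ht h).trans (le_abs_self _)
    · rw [abs_of_nonneg (sub_nonneg.2 h)]
      exact (hexp t ht s hs h).trans (le_abs_self _)
  refine ⟨m⁻¹, fun x x' => ?_⟩
  have h := hle _ (hF.target_spec hp x).1 _ (hF.target_spec hp x').1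
  rw [(hF.target_spec hp x).2, (hF.target_spec hp x').2] at h
  have h1 : |max (boundary p Ft 0) (min (boundary p Ft p.ymax) x) -
      max (boundary p Ft 0) (min (boundary p Ft p.ymax) x')| ≤ |x - x'| := by
    refine (abs_max_sub_max_le_max _ _ _ _).trans (max_le (by simp) ?_)
    exact (abs_min_sub_min_le_max _ _ _ _).trans (max_le (by simp) le_rfl)
  rw [inv_mul_eq_div, le_div_iff₀ hm, mul_comm]
  exact h.trans h1

lemma continuous_target (hF : IsShiftedBoundary p Ft) (hp : p.Admissible) :
    Continuous (target p Ft) := by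
  obtain ⟨K, hK⟩ := hF.exists_target_lipschitz hp
  refine (LipschitzWith.of_dist_le_mul (K := K.toNNReal) fun x x' => ?_).continuous
  rw [Real.dist_eq, Real.dist_eq]
  exact (hK x x').trans (mul_le_mul_of_nonneg_right (Real.le_coe_toNNReal K) (abs_nonneg _))

lemma level_mem (hF : IsShiftedBoundary p Ft) (hp : p.Admissible)
    {x y : ℝ} (hy : y ∈ Icc 0 p.ymax) : level p Ft x y ∈ Icc 0 p.ymax :=
  ⟨le_max_of_le_left hy.1, max_le hy.2 (hF.target_spec hp x).1.2⟩

lemma level_eq_self (hF : IsShiftedBoundary p Ft) (hp : p.Admissible)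
    {x y : ℝ} (hy : y ∈ Icc 0 p.ymax) (hx : x ≤ boundary p Ft y) :
    level p Ft x y = y :=
  max_eq_left (hF.target_le hp hy hx)

lemma level_eq_target (hF : IsShiftedBoundary p Ft) (hp : p.Admissible)
    {x y : ℝ} (hy : y ∈ Icc 0 p.ymax) (hx : boundary p Ft y ≤ x) :
    level p Ft x y = target p Ft x :=
  max_eq_right (hF.le_target hp hy hx)

/-- The alternative required by the envelope lemma: strictly inside the waiting region or beyond
`x̄` the level is frozen; otherwise the pair lies on the free boundary, where smooth fit holds. -/
lemma level_locally_const_or (hF : IsShiftedBoundary p Ft) (hp : p.Admissible)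
    {x y : ℝ} (hy : y ∈ Icc 0 p.ymax) :
    (∀ᶠ s in 𝓝 x, level p Ft s y = level p Ft x y) ∨
      boundary p Ft (level p Ft x y) = x := by
  rcases lt_or_ge x (boundary p Ft y) with hx | hx
  · left
    filter_upwards [Iio_mem_nhds hx] with s hs
    rw [hF.level_eq_self hp hy (le_of_lt hs), hF.level_eq_self hp hy hx.le]
  rcases lt_or_ge (boundary p Ft p.ymax) x with hx' | hx'
  · left
    have hyb := (hF.strictMonoOn_boundary hp).monotoneOn hy
      (right_mem_Icc.2 hp.ymax_pos.le) hy.2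
    filter_upwards [Ioi_mem_nhds hx'] with s hs
    rw [hF.level_eq_target hp hy (hyb.trans (le_of_lt hs)), hF.level_eq_target hp hy hx,
      hF.target_eq_ymax hp hx'.le, hF.target_eq_ymax hp (le_of_lt hs)]
  · right
    rw [hF.level_eq_target hp hy hx, hF.boundary_target hp (((hF.strictMonoOn_boundary
      hp).monotoneOn (left_mem_Icc.2 hp.ymax_pos.le) hy hy.1).trans hx) hx']

lemma continuous_level (hF : IsShiftedBoundary p Ft) (hp : p.Admissible) :
    Continuous fun q : ℝ × ℝ => level p Ft q.1 q.2 :=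
  continuous_snd.max ((hF.continuous_target hp).comp continuous_fst)

end IsShiftedBoundary

end Level

/-! ### The candidate on the whole domain -/

section Candidate

variable {p : Params} {Ft : ℝ → ℝ} {R₀ : ℝ → ℝ → ℝ}

/-- The candidate, as the waiting value at the optimal level minus the installation cost. -/
noncomputable def reducedValue (p : Params) (Ft : ℝ → ℝ) (x y : ℝ) : ℝ :=
  waitValue p Ft x (level p Ft x y) - p.c * (level p Ft x y - y)

lemma IsShiftedBoundary.candidate_eq (hF : IsShiftedBoundary p Ft) (hp : p.Admissible)
    (hR : ∀ x, ∀ y ∈ Icc 0 p.ymax, R₀ x y = profit p x y) (x : ℝ) {y : ℝ}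
    (hy : y ∈ Icc 0 p.ymax) : candidate p Ft R₀ x y = reducedValue p Ft x y := by
  rw [candidate, reducedValue]
  split_ifs with h1 h2
  · have hx : x < boundary p Ft y := by
      rcases h1 with h1 | h1
      · exact h1.2
      · obtain ⟨h1, h2⟩ := h1
        simp only [mem_singleton_iff] at h2
        rw [h2]
        exact h1
    rw [hF.level_eq_self hp hy hx.le, waitValue, hR x y hy, psiD_zero]
    ring
  · obtain ⟨-, hx0, hx1⟩ := h2
    simp only [xbar] at hx0 hx1
    have h0 := (hF.strictMonoOn_boundary hp).monotoneOn (left_mem_Icc.2 hp.ymax_pos.le) hy hy.1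
    have ht : target p Ft x = boundaryInv p Ft x := by
      rw [target, min_eq_right (le_of_lt hx1), max_eq_right (h0.trans hx0)]
    rw [hF.level_eq_target hp hy hx0, ← ht, waitValue, hR x _ (hF.target_spec hp x).1, psiD_zero]
  · have hx : boundary p Ft p.ymax ≤ x := by
      by_contra hcon
      push Not at hcon
      rcases lt_or_eq_of_le hy.2 with hlt | heq
      · have hyx : boundary p Ft y ≤ x := by
          by_contra hc
          push Not at hc
          exact h1 (Or.inl ⟨⟨hy.1, hlt⟩, hc⟩)
        exact h2 ⟨⟨hy.1, hlt⟩, hyx, hcon⟩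
      · exact h1 (Or.inr ⟨hcon, heq⟩)
    have hyx := ((hF.strictMonoOn_boundary hp).monotoneOn hy
      (right_mem_Icc.2 hp.ymax_pos.le) hy.2).trans hx
    rw [hF.level_eq_target hp hy hyx, hF.target_eq_ymax hp hx, waitValue,
      hF.coeffA_terminal hp, hR x _ (right_mem_Icc.2 hp.ymax_pos.le)]
    ring

lemma IsShiftedBoundary.hasDerivAt_reducedValue (hF : IsShiftedBoundary p Ft)
    (hp : p.Admissible) (x : ℝ) {y : ℝ} (hy : y ∈ Icc 0 p.ymax) :
    HasDerivAt (fun s => reducedValue p Ft s y) (waitX p Ft x (level p Ft x y)) x := by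
  obtain ⟨K, hK⟩ := hF.exists_target_lipschitz hp
  refine hasDerivAt_envelope (g := fun s t => waitValue p Ft s t - p.c * (t - y))
    (gx := waitX p Ft) (S := Icc 0 p.ymax) (B := fun s => level p Ft s y) (K := K)
    (fun s => hF.level_mem hp hy) (fun s t _ => (hasDerivAt_waitValue hp s t).sub_const _)
    (hF.continuousOn_waitX hp) (fun s => ?_) ?_
  · refine (abs_max_sub_max_le_max _ _ _ _).trans (max_le ?_ (hK s x))
    rw [sub_self, abs_zero]
    exact (abs_nonneg _).trans (hK s x)
  -- On the free boundary, criticality in the level is the condition `w_y = c`.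
  · refine (hF.level_locally_const_or hp hy).imp id fun h => ?_
    have hl := hF.level_mem hp (x := x) hy
    refine ((hF.hasDerivWithinAt_waitValue hp x _ hl).sub
      (((hasDerivAt_id _).sub_const y).const_mul p.c).hasDerivWithinAt).congr_deriv ?_
    have := waitY_boundary (Ft := Ft) hp (level p Ft x y)
    rw [h] at this
    rw [this]
    ring

lemma IsShiftedBoundary.hasDerivAt_waitX_level (hF : IsShiftedBoundary p Ft)
    (hp : p.Admissible) (x : ℝ) {y : ℝ} (hy : y ∈ Icc 0 p.ymax) :
    HasDerivAt (fun s => waitX p Ft s (level p Ft s y)) (waitXX p Ft x (level p Ft x y)) x := by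
  obtain ⟨K, hK⟩ := hF.exists_target_lipschitz hp
  refine hasDerivAt_envelope (g := waitX p Ft)
    (gx := waitXX p Ft) (S := Icc 0 p.ymax) (B := fun s => level p Ft s y) (K := K)
    (fun s => hF.level_mem hp hy) (fun s t _ => hasDerivAt_waitX hp s t)
    (hF.continuousOn_waitXX hp) (fun s => ?_) ?_
  · refine (abs_max_sub_max_le_max _ _ _ _).trans (max_le ?_ (hK s x))
    rw [sub_self, abs_zero]
    exact (abs_nonneg _).trans (hK s x)
  -- Here criticality is the second smooth-fit condition, `w_xy = 0`.
  · refine (hF.level_locally_const_or hp hy).imp id fun h => ?_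
    have hl := hF.level_mem hp (x := x) hy
    refine (hF.hasDerivWithinAt_waitX hp x _ hl).congr_deriv ?_
    have := waitXY_boundary (Ft := Ft) hp (level p Ft x y)
    rwa [h] at this

lemma IsShiftedBoundary.hasDerivWithinAt_reducedValue (hF : IsShiftedBoundary p Ft)
    (hp : p.Admissible) (x : ℝ) {y : ℝ} (hy : y ∈ Icc 0 p.ymax) :
    HasDerivWithinAt (fun t => reducedValue p Ft x t) (waitY p Ft (min x (boundary p Ft y)) y)
      (Icc 0 p.ymax) y := by
  have hcont := hF.continuousOn_boundary y hy
  have hwait := hF.hasDerivWithinAt_waitValue hp x y hy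
  have hlin : HasDerivAt (fun t => waitValue p Ft x (target p Ft x) -
      p.c * (target p Ft x - t)) p.c y := by
    refine ((((hasDerivAt_id y).const_sub (target p Ft x)).const_mul p.c).const_sub
      (waitValue p Ft x (target p Ft x))).congr_deriv ?_
    ring
  have hleft : ∀ t ∈ Icc 0 p.ymax, x ≤ boundary p Ft t →
      reducedValue p Ft x t = waitValue p Ft x t := fun t ht hx => by
    rw [reducedValue, hF.level_eq_self hp ht hx]; ring
  have hright : ∀ t ∈ Icc 0 p.ymax, boundary p Ft t ≤ x → reducedValue p Ft x t =
      waitValue p Ft x (target p Ft x) - p.c * (target p Ft x - t) := fun t ht hx => by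
    rw [reducedValue, hF.level_eq_target hp ht hx]
  rcases lt_trichotomy x (boundary p Ft y) with hx | hx | hx
  · rw [min_eq_left hx.le]
    refine hwait.congr_of_eventuallyEq ?_ (hleft y hy hx.le)
    filter_upwards [hcont (Ioi_mem_nhds hx), self_mem_nhdsWithin] with t ht ht'
    exact hleft t ht' (le_of_lt ht)
  -- On the boundary itself, increasing the level leads into the waiting region and decreasing it
  -- into the installation region. The two one-sided derivatives are both `c`.
  · rw [min_eq_right hx.ge, waitY_boundary hp]
    rw [hx, waitY_boundary hp, ← hx] at hwait
    have hmono := (hF.strictMonoOn_boundary hp).monotoneOn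
    have hu : HasDerivWithinAt (fun t => reducedValue p Ft x t) p.c
        (Icc 0 p.ymax ∩ Ici y) y := by
      refine (hwait.mono inter_subset_left).congr (fun t ht => ?_) (hleft y hy hx.le)
      exact hleft t ht.1 (hx.le.trans (hmono hy ht.1 ht.2))
    have hl : HasDerivWithinAt (fun t => reducedValue p Ft x t) p.c
        (Icc 0 p.ymax ∩ Iic y) y := by
      refine hlin.hasDerivWithinAt.congr (fun t ht => ?_) (hright y hy hx.ge)
      exact hright t ht.1 ((hmono ht.1 hy ht.2).trans hx.ge)
    refine (hu.union hl).mono fun t ht => ?_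
    rcases le_total y t with h | h
    · exact Or.inl ⟨ht, h⟩
    · exact Or.inr ⟨ht, h⟩
  · rw [min_eq_right hx.le, waitY_boundary hp]
    refine hlin.hasDerivWithinAt.congr_of_eventuallyEq ?_ (hright y hy hx.le)
    filter_upwards [hcont (Iio_mem_nhds hx), self_mem_nhdsWithin] with t ht ht'
    exact hright t ht' (le_of_lt ht)

lemma IsShiftedBoundary.dx_candidate (hF : IsShiftedBoundary p Ft) (hp : p.Admissible)
    (hR : ∀ x, ∀ y ∈ Icc 0 p.ymax, R₀ x y = profit p x y) (x : ℝ) {y : ℝ}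
    (hy : y ∈ Icc 0 p.ymax) :
    HasDerivAt (fun s => candidate p Ft R₀ s y) (dx (candidate p Ft R₀) x y) x ∧
      dx (candidate p Ft R₀) x y = waitX p Ft x (level p Ft x y) := by
  have h : HasDerivAt (fun s => candidate p Ft R₀ s y) (waitX p Ft x (level p Ft x y)) x := by
    rw [funext fun s => hF.candidate_eq hp hR s hy]
    exact hF.hasDerivAt_reducedValue hp x hy
  exact ⟨h.differentiableAt.hasDerivAt, h.deriv⟩

lemma IsShiftedBoundary.dxx_candidate (hF : IsShiftedBoundary p Ft) (hp : p.Admissible)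
    (hR : ∀ x, ∀ y ∈ Icc 0 p.ymax, R₀ x y = profit p x y) (x : ℝ) {y : ℝ}
    (hy : y ∈ Icc 0 p.ymax) :
    HasDerivAt (fun s => dx (candidate p Ft R₀) s y) (dxx (candidate p Ft R₀) x y) x ∧
      dxx (candidate p Ft R₀) x y = waitXX p Ft x (level p Ft x y) := by
  have h : HasDerivAt (fun s => dx (candidate p Ft R₀) s y)
      (waitXX p Ft x (level p Ft x y)) x := by
    rw [funext fun s => (hF.dx_candidate hp hR s hy).2]
    exact hF.hasDerivAt_waitX_level hp x hy
  exact ⟨h.differentiableAt.hasDerivAt, h.deriv⟩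

lemma IsShiftedBoundary.dy_candidate (hF : IsShiftedBoundary p Ft) (hp : p.Admissible)
    (hR : ∀ x, ∀ y ∈ Icc 0 p.ymax, R₀ x y = profit p x y) (x : ℝ) {y : ℝ}
    (hy : y ∈ Icc 0 p.ymax) :
    DifferentiableWithinAt ℝ (fun t => candidate p Ft R₀ x t) (Icc 0 p.ymax) y ∧
      dy p.ymax (candidate p Ft R₀) x y = waitY p Ft (min x (boundary p Ft y)) y := by
  have h : HasDerivWithinAt (fun t => candidate p Ft R₀ x t)
      (waitY p Ft (min x (boundary p Ft y)) y) (Icc 0 p.ymax) y :=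
    (hF.hasDerivWithinAt_reducedValue hp x hy).congr (fun t ht => hF.candidate_eq hp hR x ht)
      (hF.candidate_eq hp hR x hy)
  exact ⟨h.differentiableWithinAt, h.derivWithin (uniqueDiffOn_Icc hp.ymax_pos y hy)⟩

theorem IsShiftedBoundary.isC21_candidate (hF : IsShiftedBoundary p Ft) (hp : p.Admissible)
    (hR : ∀ x, ∀ y ∈ Icc 0 p.ymax, R₀ x y = profit p x y) :
    IsC21 p.ymax (candidate p Ft R₀) := by
  have hlev : ContinuousOn (fun q : ℝ × ℝ => (q.1, level p Ft q.1 q.2))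
      (univ ×ˢ Icc 0 p.ymax) :=
    (continuous_fst.prodMk (hF.continuous_level hp)).continuousOn
  have hmaps : MapsTo (fun q : ℝ × ℝ => (q.1, level p Ft q.1 q.2))
      (univ ×ˢ Icc 0 p.ymax) (univ ×ˢ Icc 0 p.ymax) :=
    fun q hq => ⟨mem_univ _, hF.level_mem hp hq.2⟩
  refine ⟨fun x y hy => (hF.dx_candidate hp hR x hy).1.differentiableAt,
    fun x y hy => (hF.dxx_candidate hp hR x hy).1.differentiableAt,
    fun x y hy => (hF.dy_candidate hp hR x hy).1, ?_, ?_, ?_, ?_⟩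
  · refine ContinuousOn.congr (f := fun q : ℝ × ℝ => reducedValue p Ft q.1 q.2) ?_
      fun q hq => hF.candidate_eq hp hR q.1 hq.2
    refine ((hF.continuousOn_waitValue hp).comp hlev hmaps).sub (Continuous.continuousOn ?_)
    exact continuous_const.mul ((hF.continuous_level hp).sub continuous_snd)
  · exact ((hF.continuousOn_waitX hp).comp hlev hmaps).congr
      fun q hq => (hF.dx_candidate hp hR q.1 hq.2).2
  · exact ((hF.continuousOn_waitXX hp).comp hlev hmaps).congr
      fun q hq => (hF.dxx_candidate hp hR q.1 hq.2).2
  · have hb : ContinuousOn (fun q : ℝ × ℝ => boundary p Ft q.2) (univ ×ˢ Icc 0 p.ymax) :=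
      hF.continuousOn_boundary.comp continuousOn_snd fun q hq => hq.2
    have hm : ContinuousOn (fun q : ℝ × ℝ => (min q.1 (boundary p Ft q.2), q.2))
        (univ ×ˢ Icc 0 p.ymax) := (ContinuousOn.inf continuousOn_fst hb).prodMk continuousOn_snd
    exact ((hF.continuousOn_waitY hp).comp hm fun q hq => ⟨mem_univ _, hq.2⟩).congr
      fun q hq => (hF.dy_candidate hp hR q.1 hq.2).2

/-- The waiting value solves the equation at the reached level, not at `y`. What remains are the
differences in drift, running profit and discounted cost, each proportional to `level - y`. -/
lemma IsShiftedBoundary.generator_candidate (hF : IsShiftedBoundary p Ft) (hp : p.Admissible)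
    (hR : ∀ x, ∀ y ∈ Icc 0 p.ymax, R₀ x y = profit p x y) (x : ℝ) {y : ℝ}
    (hy : y ∈ Icc 0 p.ymax) :
    generator p (candidate p Ft R₀) x y - p.ρ * candidate p Ft R₀ x y + x * y =
      (level p Ft x y - y) *
        (p.κ * p.β * waitX p Ft x (level p Ft x y) + p.ρ * p.c - x) := by
  rw [generator, (hF.dx_candidate hp hR x hy).2, (hF.dxx_candidate hp hR x hy).2,
    hF.candidate_eq hp hR x hy, reducedValue]
  linear_combination waitValue_ode (Ft := Ft) hp x (level p Ft x y)

lemma IsShiftedBoundary.generator_candidate_nonpos (hF : IsShiftedBoundary p Ft)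
    (hp : p.Admissible) (hR : ∀ x, ∀ y ∈ Icc 0 p.ymax, R₀ x y = profit p x y) {x y : ℝ}
    (hy : y ∈ Icc 0 p.ymax) (hx : boundary p Ft y ≤ x) :
    generator p (candidate p Ft R₀) x y - p.ρ * candidate p Ft R₀ x y + x * y ≤ 0 := by
  rw [hF.generator_candidate hp hR x hy]
  refine mul_nonpos_of_nonneg_of_nonpos (sub_nonneg.2 (le_max_left _ _)) ?_
  rw [hF.level_eq_target hp hy hx]
  have hT : p.ymax ∈ Icc 0 p.ymax := right_mem_Icc.2 hp.ymax_pos.le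
  rcases le_total x (boundary p Ft p.ymax) with hx' | hx'
  · have h := hF.installation_bracket hp (hF.target_spec hp x).1
    rw [hF.boundary_target hp (((hF.strictMonoOn_boundary
      hp).monotoneOn (left_mem_Icc.2 hp.ymax_pos.le) hy hy.1).trans hx) hx'] at h
    exact h.le
  -- Beyond `x̄` the level stays at `ymax`, where `A = 0`. The bracket is then affine in `x` with
  -- slope `-1`, so its sign at `x̄` suffices.
  · have h := hF.installation_bracket hp hT
    rw [hF.target_eq_ymax hp hx']
    rw [waitX, hF.coeffA_terminal hp, zero_mul, zero_add] at h ⊢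
    linarith

end Candidate

end SolarInstallation

/-! ### Assembly of the proposition -/

theorem proposition4p7 {Ω : Type*} [MeasurableSpace Ω] (P : Measure Ω)
    (W : ℝ≥0 → Ω → ℝ) (hW : IsBrownianReal W P)
    (p : SolarInstallation.Params) (hp : p.Admissible)
    (X : ℝ → ℝ → ℝ≥0 → Ω → ℝ)
    (hX : ∀ x : ℝ, ∀ y ∈ Icc 0 p.ymax, SolarInstallation.IsPriceProcess P W p x y (X x y)) :
    (∃ Ft : ℝ → ℝ, SolarInstallation.IsShiftedBoundary p Ft) ∧
    ∀ Ft : ℝ → ℝ, SolarInstallation.IsShiftedBoundary p Ft →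
      StrictMonoOn (SolarInstallation.boundary p Ft) (Icc 0 p.ymax) ∧
      ∀ w : ℝ → ℝ → ℝ,
        w = SolarInstallation.candidate p Ft (SolarInstallation.R P X p) →
        SolarInstallation.IsC21 p.ymax w ∧
        (∀ x : ℝ, w x p.ymax = SolarInstallation.R P X p x p.ymax) ∧
        (∀ x : ℝ, ∀ y ∈ Ico 0 p.ymax,
          max (SolarInstallation.generator p w x y - p.ρ * w x y + x * y)
            (SolarInstallation.dy p.ymax w x y - p.c) = 0) ∧
        (∀ x y : ℝ, (x, y) ∈ SolarInstallation.waiting p Ft →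
          SolarInstallation.generator p w x y - p.ρ * w x y + x * y = 0) ∧
        (∀ x y : ℝ, (x, y) ∈ SolarInstallation.installation p Ft →
          SolarInstallation.dy p.ymax w x y = p.c) := by
  have hR : ∀ x, ∀ y ∈ Icc 0 p.ymax,
      SolarInstallation.R P X p x y = SolarInstallation.profit p x y :=
    fun x y hy => SolarInstallation.R_eq_profit hW hp (hX x y hy)
  refine ⟨SolarInstallation.exists_isShiftedBoundary hp, fun Ft hF =>
    ⟨hF.strictMonoOn_boundary hp, ?_⟩⟩
  rintro w rfl
  have hT : p.ymax ∈ Icc 0 p.ymax := right_mem_Icc.2 hp.ymax_pos.le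
  have hgen : ∀ x, ∀ y ∈ Ico 0 p.ymax, x < SolarInstallation.boundary p Ft y →
      SolarInstallation.generator p
        (SolarInstallation.candidate p Ft (SolarInstallation.R P X p)) x y
        - p.ρ * SolarInstallation.candidate p Ft (SolarInstallation.R P X p) x y + x * y = 0 :=
    fun x y hy hx => by
      rw [hF.generator_candidate hp hR x (Ico_subset_Icc_self hy),
        hF.level_eq_self hp (Ico_subset_Icc_self hy) hx.le, sub_self, zero_mul]
  have hdy : ∀ x, ∀ y ∈ Ico 0 p.ymax, SolarInstallation.boundary p Ft y ≤ x →
      SolarInstallation.dy p.ymax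
        (SolarInstallation.candidate p Ft (SolarInstallation.R P X p)) x y = p.c :=
    fun x y hy hx => by
      rw [(hF.dy_candidate hp hR x (Ico_subset_Icc_self hy)).2, min_eq_right hx,
        SolarInstallation.waitY_boundary hp]
  refine ⟨hF.isC21_candidate hp hR, fun x => ?_, fun x y hy => ?_,
    fun x y h => hgen x y h.1 h.2, fun x y h => hdy x y h.1 h.2⟩
  · have hlev : SolarInstallation.level p Ft x p.ymax = p.ymax :=
      le_antisymm (hF.level_mem hp hT).2 (le_max_left _ _)
    rw [hF.candidate_eq hp hR x hT, SolarInstallation.reducedValue, hlev,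
      SolarInstallation.waitValue, hF.coeffA_terminal hp, hR x _ hT]
    ring
  · rcases lt_or_ge x (SolarInstallation.boundary p Ft y) with hx | hx
    · rw [hgen x y hy hx]
      refine max_eq_left ?_
      rw [(hF.dy_candidate hp hR x (Ico_subset_Icc_self hy)).2, min_eq_left hx.le, sub_nonpos]
      exact hF.waitY_le hp (Ico_subset_Icc_self hy) hx.le
    · rw [hdy x y hy hx, sub_self]
      exact max_eq_right (hF.generator_candidate_nonpos hp hR (Ico_subset_Icc_self hy) hx)
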